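/- Let $d\ge 0$ be an integer and $n\ge 0$ a real number, and let $\mu,\nu$ be (positive) Radon measures on $\mathbb{R}^d$. The measure $\nu$ has $n$-growth if there is $c>0$ with $\nu(B(x,r))\le c\,r^n$ for all $x\in\mathbb{R}^d$, $r>0$. The measure $\mu$ is $n$-AD-regular if there is $c>0$ with $c^{-1}r^n\le\mu(B(x,r))\le c\,r^n$ for all $x\in\operatorname{spt}\mu$ and all finite $r$ with $0<r\le\operatorname{diam}(\operatorname{spt}\mu)$. Balls are closed. A function $k(x,y)\in\mathbb{C}$, defined for $x\ne y$ in $\mathbb{R}^d$, is an $n$-dimensional Calderón–Zygmund kernel if there are $c>0$ and $0<\eta\le1$ such that for all $x\neq y$ $$|k(x,y)|\le \frac{c}{|x-y|^{n}},\qquad |k(x,y)-k(x',y)|+|k(y,x)-k(y,x')|\le \frac{c\,|x-x'|^{\eta}}{|x-y|^{n+\eta}}\ \text{ if } |x-x'|\le \tfrac12|x-y|.$$ For $\varepsilon>0$ and a finite complex Borel measure $\sigma$ on $\mathbb{R}^d$ put $T^k_\varepsilon\sigma(x)=\int_{|x-y|>\varepsilon}k(x,y)\,d\sigma(y)$, and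 for a positive Radon measure $\tau$ and $f\in L^p(\tau)$ put $T^k_{\tau,\varepsilon}f(x)=\int_{|x-y|>\varepsilon}k(x,y)f(y)\,d\tau(y)$. For positive Radon measures $\tau,\rho$ we say: * $T^k_\tau$ is bounded from $L^p(\tau)$ to $L^p(\rho)$ if there is $C$ with $\|T^k_{\tau,\varepsilon}f\|_{L^p(\rho)}\le C\|f\|_{L^p(\tau)}$ for all $\varepsilon>0$, $f\in L^p(\tau)$; * $T^k_\tau$ is bounded from $L^p(\tau)$ to $L^{p,\infty}(\rho)$ if there is $C$ with $\rho\{x:|T^k_{\tau,\varepsilon}f(x)|>\lambda\}\le C\lambda^{-p}\|f\|_{L^p(\tau)}^p$ for all $\varepsilon>0$, $f\in L^p(\tau)$, $\lambda>0$; * $T^k$ is bounded from $M(K)$ to $L^{1,\infty}(\rho)$, where $M(K)$ is the space of finite complex Borel measures carried by the closed set $K\subset\mathbb{R}^d$ with the total variation norm, if there is $C$ with $\rho\{x:|T^k_{\varepsilon}\sigma(x)|>\lambda\}\le C\lambda^{-1}\|\sigma\|$ for all $\varepsilon>0$, $\sigma\in M(K)$, $\lambda>0$. **Theorem 4.1.**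 Let $\mu$ be $n$-AD-regular and, if $n>0$, suppose that $\operatorname{spt}\mu$ is not a single point. Let $\nu$ have $n$-growth, and let $k$ be an $n$-dimensional Calderón–Zygmund kernel such that $T^k_\mu$ is bounded from $L^2(\mu)$ to $L^2(\mu)$. Then: 1. for every $1<p<\infty$, $T^k_\nu$ is bounded from $L^p(\nu)$ to $L^{p,\infty}(\mu)$, and $T^k_\mu$ is bounded from $L^p(\mu)$ to $L^{p,\infty}(\nu)$; 2. $T^k$ is bounded from $M(\operatorname{spt}\mu)$ to $L^{1,\infty}(\nu)$; 3. consequently (David's theorem), for every $1<p<\infty$, $T^k_\nu$ is bounded from $L^p(\nu)$ to $L^p(\mu)$, and $T^k_\mu$ is bounded from $L^p(\mu)$ to $L^p(\nu)$. -/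

import Mathlib

open MeasureTheory
open scoped ENNReal NNReal

noncomputable section

/-- A measure on `ℝ^d` has `n`-growth: `μ (B(x, r)) ≤ c r ^ n` for all points `x` and radii `r`. -/
def HasGrowth {d : ℕ} (n : ℝ) (μ : Measure (EuclideanSpace ℝ (Fin d))) : Prop :=
  ∃ c : ℝ, 0 < c ∧ ∀ (x : EuclideanSpace ℝ (Fin d)) (r : ℝ), 0 < r →
    μ (Metric.closedBall x r) ≤ ENNReal.ofReal (c * r ^ n)

/-- `n`-Ahlfors-David regularity: `c⁻¹ r ^ n ≤ μ (B(x, r)) ≤ c r ^ n` for every `x` in the support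
and every finite `0 < r ≤ diam (spt μ)`; the diameter is extended-real valued. -/
def IsADRegular {d : ℕ} (n : ℝ) (μ : Measure (EuclideanSpace ℝ (Fin d))) : Prop :=
  ∃ c : ℝ, 0 < c ∧ ∀ x ∈ μ.support, ∀ r : ℝ, 0 < r → ENNReal.ofReal r ≤ Metric.ediam μ.support →
    ENNReal.ofReal (c⁻¹ * r ^ n) ≤ μ (Metric.closedBall x r) ∧
      μ (Metric.closedBall x r) ≤ ENNReal.ofReal (c * r ^ n)

/-- `n`-dimensional Calderón-Zygmund kernels. Only the values off the diagonal matter. -/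
def IsCZKernel {d : ℕ} (n : ℝ)
    (k : EuclideanSpace ℝ (Fin d) → EuclideanSpace ℝ (Fin d) → ℂ) : Prop :=
  ∃ c η : ℝ, 0 < c ∧ 0 < η ∧ η ≤ 1 ∧
    (∀ x y, x ≠ y → ‖k x y‖ ≤ c / ‖x - y‖ ^ n) ∧
    (∀ x y x', x ≠ y → ‖x - x'‖ ≤ ‖x - y‖ / 2 →
      ‖k x y - k x' y‖ + ‖k y x - k y x'‖ ≤ c * ‖x - x'‖ ^ η / ‖x - y‖ ^ (n + η))

/-- The truncated operator `T_{ν,ε} f (x) = ∫_{|x-y| > ε} k(x,y) f(y) dν(y)`. -/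
def truncOp {d : ℕ} (k : EuclideanSpace ℝ (Fin d) → EuclideanSpace ℝ (Fin d) → ℂ)
    (ν : Measure (EuclideanSpace ℝ (Fin d))) (ε : ℝ)
    (f : EuclideanSpace ℝ (Fin d) → ℂ) (x : EuclideanSpace ℝ (Fin d)) : ℂ :=
  ∫ y in {y | ε < ‖x - y‖}, k x y * f y ∂ν

/-- The truncated operator `T_ε σ (x) = ∫_{|x-y| > ε} k(x,y) dσ(y)` on a finite complex Borel
measure `σ`. -/
def truncOpMeasure {d : ℕ} (k : EuclideanSpace ℝ (Fin d) → EuclideanSpace ℝ (Fin d) → ℂ)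
    (ε : ℝ) (σ : ComplexMeasure (EuclideanSpace ℝ (Fin d)))
    (x : EuclideanSpace ℝ (Fin d)) : ℂ :=
  VectorMeasure.integral (VectorMeasure.restrict σ {y | ε < ‖x - y‖}) (fun y => k x y)
    (ContinuousLinearMap.mul ℝ ℂ)

/-- `T_ν` is bounded from `L^p(ν)` to `L^p(μ)`: the truncations are bounded uniformly in `ε`. -/
def IsBoundedStrong {d : ℕ} (k : EuclideanSpace ℝ (Fin d) → EuclideanSpace ℝ (Fin d) → ℂ)
    (p : ℝ) (ν μ : Measure (EuclideanSpace ℝ (Fin d))) : Prop :=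
  ∃ C : ℝ≥0, ∀ ε : ℝ, 0 < ε → ∀ f : EuclideanSpace ℝ (Fin d) → ℂ,
    MemLp f (ENNReal.ofReal p) ν →
      eLpNorm (truncOp k ν ε f) (ENNReal.ofReal p) μ ≤ C * eLpNorm f (ENNReal.ofReal p) ν

/-- `T_ν` is bounded from `L^p(ν)` to `L^{p,∞}(μ)`:
`μ {x : |T_{ν,ε} f (x)| > t} ≤ C t⁻ᵖ ‖f‖_{L^p(ν)}^p` for all `t > 0`, uniformly in `ε`. -/
def IsBoundedWeak {d : ℕ} (k : EuclideanSpace ℝ (Fin d) → EuclideanSpace ℝ (Fin d) → ℂ)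
    (p : ℝ) (ν μ : Measure (EuclideanSpace ℝ (Fin d))) : Prop :=
  ∃ C : ℝ≥0, ∀ ε : ℝ, 0 < ε → ∀ f : EuclideanSpace ℝ (Fin d) → ℂ,
    MemLp f (ENNReal.ofReal p) ν → ∀ t : ℝ, 0 < t →
      μ {x | t < ‖truncOp k ν ε f x‖} ≤
        C / ENNReal.ofReal (t ^ p) * eLpNorm f (ENNReal.ofReal p) ν ^ p

/-- `T` is bounded from `M(K)` to `L^{1,∞}(ν)`, where `M(K)` is the space of finite complex Borel
measures on `ℝ^d` that are carried by `K`, with the total variation norm: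
`ν {x : |T_ε σ (x)| > t} ≤ C t⁻¹ ‖σ‖` for all `t > 0`, uniformly in `ε`. -/
def IsBoundedMeasureWeak {d : ℕ} (k : EuclideanSpace ℝ (Fin d) → EuclideanSpace ℝ (Fin d) → ℂ)
    (K : Set (EuclideanSpace ℝ (Fin d))) (ν : Measure (EuclideanSpace ℝ (Fin d))) : Prop :=
  ∃ C : ℝ≥0, ∀ ε : ℝ, 0 < ε → ∀ σ : ComplexMeasure (EuclideanSpace ℝ (Fin d)),
    σ.variation Kᶜ = 0 → ∀ t : ℝ, 0 < t →
      ν {x | t < ‖truncOpMeasure k ε σ x‖} ≤ C * σ.variation Set.univ / ENNReal.ofReal t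

end

/-! The substance is the case `n > 0` with nonempty support. Strong bounds are proved for all
exponents, and the weak bounds for `1 < p` then follow by Chebyshev.

The passage from `μ` to `ν` rests on a Cotlar-type inequality valid at every point of space
(`CZBound.norm_truncOp_le_of_maximal_le`). Let `x'` be a point of the support nearest to `x`, and
`r` the larger of `ε` and `|x - x'|`. The part of `f` within `4r` of `x` is harmless, since the
truncated kernel is at most `c / r^n` there. The rest contributes almost the same amount at `x` as
at any `z` in `B(x', r)`, by smoothness of the kernel. Averaging over `z` with respect to `μ`, whose
mass on that ball is at least a multiple of `r^n`, bounds the operator by a radial maximal function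
of `|f|^q + |T f|^q`. That maximal function is of weak type `(1,1)` into any measure of `n`-growth,
by a Vitali covering (`measure_maximal_gt_le`). Hence an `L^q(μ)` bound becomes a weak `(q,q)` bound
into `ν`.

For weak type `(1,1)`, a positive measure carried by the support of `μ` is decomposed at height `t`
(`ADBound.exists_calderonZygmund_decomposition`). Its mass on the bad balls is spread uniformly with
respect to `μ`. The good part has density of order `t` and is handled by the weak `(2,2)` bound. The
bad part has cancellation and is integrated away from the balls (`CZBound.lintegral_enorm_sub_le`).
Splitting a complex measure into four positive ones gives the bound on `M(spt μ)`.

Marcinkiewicz interpolation between `1` and `q` gives strong bounds from `μ` to `ν` below `q`.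
Exponents `q > 2` on `L^q(μ)` come from the transposed kernel, which satisfies the same hypotheses:
interpolate it below `2` and dualize. The bounds from `ν` to `μ` are the duals of those for the
transposed kernel from `μ` to `ν`.

When `n = 0` both measures are finite and the kernel is bounded, so everything follows from size
estimates. -/

/-- The Euclidean space `ℝ^d`. -/
abbrev Eu (d : ℕ) := EuclideanSpace ℝ (Fin d)

/-! ### Vitali coverings, the maximal function and comparison of measures by density. -/

theorem exists_countable_vitali_cover {d : ℕ} (S : Set (Eu d)) (r : Eu d → ℝ) (R : ℝ)
    (hr : ∀ x ∈ S, 0 < r x ∧ r x ≤ R) :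
    ∃ u ⊆ S, u.Countable ∧ (u.PairwiseDisjoint fun x => Metric.closedBall x (r x)) ∧
      S ⊆ ⋃ x ∈ u, Metric.closedBall x (5 * r x) := by
  obtain ⟨u, huS, hdisj, hcov⟩ :=
    Vitali.exists_disjoint_subfamily_covering_enlargement_closedBall S (fun x => x) r R
      (fun a ha => (hr a ha).2) 5 (by norm_num)
  refine ⟨u, huS, ?_, hdisj, ?_⟩
  · refine hdisj.countable_of_nonempty_interior fun x hx => ?_
    refine ⟨x, ?_⟩
    exact Metric.ball_subset_interior_closedBall (Metric.mem_ball_self (hr x (huS hx)).1)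
  · intro x hx
    obtain ⟨b, hb, hsub⟩ := hcov x hx
    exact Set.mem_biUnion hb (hsub (Metric.mem_closedBall_self (hr x hx).1.le))

theorem tsum_measure_closedBall_le {d : ℕ} {u : Set (Eu d)} (hu : u.Countable) {r : Eu d → ℝ}
    (hdisj : u.PairwiseDisjoint fun x => Metric.closedBall x (r x)) (G : Measure (Eu d))
    {U : Set (Eu d)} (hU : ∀ x ∈ u, Metric.closedBall x (r x) ⊆ U) :
    ∑' x : u, G (Metric.closedBall (x : Eu d) (r x)) ≤ G U := by
  rw [← measure_biUnion hu hdisj fun x _ => Metric.isClosed_closedBall.measurableSet]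
  exact measure_mono (Set.iUnion₂_subset hU)

/-- Weak type `(1,1)` bound for the radial maximal function, with respect to a measure of
`n`-growth. -/
theorem measure_maximal_gt_le {d : ℕ} {n c : ℝ} (hn : 0 < n) (hc : 0 < c) {ν : Measure (Eu d)}
    (hν : ∀ (x : Eu d) (r : ℝ), 0 < r → ν (Metric.closedBall x r) ≤ ENNReal.ofReal (c * r ^ n))
    (G : Measure (Eu d)) {A : ℝ} (hA : 0 < A) :
    ν {x | ∃ r : ℝ, 0 < r ∧ ENNReal.ofReal (A * r ^ n) < G (Metric.closedBall x r)} ≤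
      ENNReal.ofReal (c * 5 ^ n / A) * G Set.univ := by
  have hC : 0 < c * 5 ^ n / A := by positivity
  by_cases hG : G Set.univ = ∞
  · rw [hG, ENNReal.mul_top (by simpa using hC)]
    exact le_top
  set S := {x : Eu d | ∃ r : ℝ, 0 < r ∧ ENNReal.ofReal (A * r ^ n) < G (Metric.closedBall x r)}
  have hS : ∀ x : Eu d, ∃ r : ℝ, x ∈ S →
      0 < r ∧ ENNReal.ofReal (A * r ^ n) < G (Metric.closedBall x r) := fun x => by
    by_cases hx : x ∈ S
    · obtain ⟨r, hr⟩ := hx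
      exact ⟨r, fun _ => hr⟩
    · exact ⟨0, fun h => absurd h hx⟩
  choose r hr using hS
  -- The covering lemma needs bounded radii; `A * r ^ n < G Set.univ < ∞` supplies the bound because
  -- `n > 0`.
  obtain ⟨u, huS, hu, hdisj, hcov⟩ := exists_countable_vitali_cover S r
    (((G Set.univ).toReal / A) ^ n⁻¹) (fun x hx => by
      refine ⟨(hr x hx).1, ?_⟩
      rw [Real.le_rpow_inv_iff_of_pos (hr x hx).1.le (by positivity) hn, le_div_iff₀ hA, mul_comm]
      exact ((ENNReal.ofReal_lt_iff_lt_toReal (by have := (hr x hx).1; positivity) hG).1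
        ((hr x hx).2.trans_le (measure_mono (Set.subset_univ _)))).le)
  have := hu.to_subtype
  calc ν S ≤ ν (⋃ x ∈ u, Metric.closedBall x (5 * r x)) := measure_mono hcov
    _ ≤ ∑' x : u, ν (Metric.closedBall (x : Eu d) (5 * r x)) := measure_biUnion_le ν hu _
    _ ≤ ∑' x : u, ENNReal.ofReal (c * 5 ^ n / A) * G (Metric.closedBall (x : Eu d) (r x)) := by
        refine ENNReal.tsum_le_tsum fun x => ?_
        obtain ⟨h0, h1⟩ := hr x (huS x.2)
        refine (hν _ _ (by positivity)).trans ?_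
        refine le_trans (le_of_eq ?_) (mul_le_mul_right h1.le _)
        rw [← ENNReal.ofReal_mul hC.le, Real.mul_rpow (by norm_num) h0.le]
        congr 1
        field_simp
    _ = ENNReal.ofReal (c * 5 ^ n / A) * ∑' x : u, G (Metric.closedBall (x : Eu d) (r x)) :=
        ENNReal.tsum_mul_left
    _ ≤ _ := mul_le_mul_right (tsum_measure_closedBall_le hu hdisj G
        fun _ _ => Set.subset_univ _) _

/-- If `τ` has upper `n`-density at most `l` on `S`, then it is dominated on `S` by any locally
finite measure with lower `n`-density bounded below on `S`. -/
theorem measure_le_of_density_le {d : ℕ} {n c l r₀ : ℝ} (hc : 0 < c) (hl : 0 < l)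
    (hr₀ : 0 < r₀) {μ τ : Measure (Eu d)} [IsLocallyFiniteMeasure μ] {S : Set (Eu d)}
    (hμ : ∀ x ∈ S, ∀ r : ℝ, 0 < r → r ≤ r₀ →
      ENNReal.ofReal (c⁻¹ * r ^ n) ≤ μ (Metric.closedBall x r))
    (hτ : ∀ x ∈ S, ∀ r : ℝ, 0 < r → τ (Metric.closedBall x r) ≤ ENNReal.ofReal (l * r ^ n)) :
    τ S ≤ ENNReal.ofReal (c * l * 5 ^ n) * μ S := by
  have hC : 0 < c * l * 5 ^ n := by positivity
  -- By outer regularity it suffices to bound by `μ U` for open `U ⊇ S`, and the radii can be chosen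
  -- small enough to keep all the disjoint balls inside `U`.
  rw [S.measure_eq_iInf_isOpen μ]
  simp_rw [ENNReal.mul_iInf_of_ne (by simpa using hC : ENNReal.ofReal (c * l * 5 ^ n) ≠ 0)
    ENNReal.ofReal_ne_top]
  refine le_iInf fun U => le_iInf fun hSU => le_iInf fun hU => ?_
  have hS : ∀ x : Eu d, ∃ r : ℝ, x ∈ S → 0 < r ∧ r ≤ r₀ ∧ Metric.closedBall x r ⊆ U := fun x => by
    by_cases hx : x ∈ S
    · obtain ⟨e, he, hsub⟩ := Metric.nhds_basis_closedBall.mem_iff.1 (hU.mem_nhds (hSU hx))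
      exact ⟨min e r₀, fun _ => ⟨lt_min he hr₀, min_le_right _ _,
        (Metric.closedBall_subset_closedBall (min_le_left _ _)).trans hsub⟩⟩
    · exact ⟨0, fun h => absurd h hx⟩
  choose r hr using hS
  obtain ⟨u, huS, hu, hdisj, hcov⟩ := exists_countable_vitali_cover S r r₀
    (fun x hx => ⟨(hr x hx).1, (hr x hx).2.1⟩)
  have := hu.to_subtype
  calc τ S ≤ τ (⋃ x ∈ u, Metric.closedBall x (5 * r x)) := measure_mono hcov
    _ ≤ ∑' x : u, τ (Metric.closedBall (x : Eu d) (5 * r x)) := measure_biUnion_le τ hu _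
    _ ≤ ∑' x : u, ENNReal.ofReal (c * l * 5 ^ n) * μ (Metric.closedBall (x : Eu d) (r x)) := by
        refine ENNReal.tsum_le_tsum fun x => ?_
        obtain ⟨h0, h1, -⟩ := hr x (huS x.2)
        refine (hτ _ (huS x.2) _ (by positivity)).trans ?_
        refine le_trans (le_of_eq ?_) (mul_le_mul_right (hμ _ (huS x.2) _ h0 h1) _)
        rw [← ENNReal.ofReal_mul hC.le, Real.mul_rpow (by norm_num) h0.le]
        congr 1
        field_simp
    _ = ENNReal.ofReal (c * l * 5 ^ n) * ∑' x : u, μ (Metric.closedBall (x : Eu d) (r x)) :=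
        ENNReal.tsum_mul_left
    _ ≤ _ := mul_le_mul_right (tsum_measure_closedBall_le hu hdisj μ
        fun x hx => (hr x (huS hx)).2.2) _

/-! ### Tail integrals, and growth of AD-regular measures. -/

/-- Tail estimate for measures with `n`-growth around a point `x`. -/
theorem lintegral_tail_le {d : ℕ} {n η a R : ℝ} (hn : 0 < n) (hη : 0 < η) (ha : 0 ≤ a)
    (hR : 0 < R) {G : Measure (Eu d)} {x : Eu d}
    (hG : ∀ r : ℝ, 0 < r → G (Metric.closedBall x r) ≤ ENNReal.ofReal (a * r ^ n)) :
    ∫⁻ y in {y | R ≤ ‖x - y‖}, ENNReal.ofReal (1 / ‖x - y‖ ^ (n + η)) ∂G ≤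
      ENNReal.ofReal (2 ^ n / (1 - (2 ^ η)⁻¹) * a / R ^ η) := by
  have h2 : (1 : ℝ) < 2 ^ η := Real.one_lt_rpow (by norm_num) hη
  have h2' : (2 ^ η : ℝ)⁻¹ < 1 := inv_lt_one_of_one_lt₀ h2
  -- Dyadic annuli: the `j`-th one has mass at most `a * (2 ^ (j + 1) * R) ^ n` and integrand at
  -- most `(2 ^ j * R) ^ (-(n + η))`, so the contributions form a geometric series of ratio `2 ^
  -- (-η)`.
  have hcov : {y | R ≤ ‖x - y‖} ⊆
      ⋃ j : ℕ, {y | 2 ^ j * R ≤ ‖x - y‖ ∧ ‖x - y‖ < 2 ^ (j + 1) * R} := fun y hy => by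
    obtain ⟨j, hj, hj'⟩ := exists_nat_pow_near ((one_le_div hR).2 hy) (one_lt_two (α := ℝ))
    rw [le_div_iff₀ hR] at hj
    rw [div_lt_iff₀ hR] at hj'
    exact Set.mem_iUnion.2 ⟨j, hj, hj'⟩
  have hterm : ∀ j : ℕ, ∫⁻ y in {y | 2 ^ j * R ≤ ‖x - y‖ ∧ ‖x - y‖ < 2 ^ (j + 1) * R},
      ENNReal.ofReal (1 / ‖x - y‖ ^ (n + η)) ∂G ≤
        ENNReal.ofReal (2 ^ n * a / R ^ η * ((2 ^ η)⁻¹) ^ j) := fun j => by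
    have hj : 0 < 2 ^ j * R := by positivity
    calc _ ≤ ∫⁻ y in {y | 2 ^ j * R ≤ ‖x - y‖ ∧ ‖x - y‖ < 2 ^ (j + 1) * R},
          ENNReal.ofReal (1 / (2 ^ j * R) ^ (n + η)) ∂G := by
          refine setLIntegral_mono' ?_ fun y hy => ?_
          · measurability
          · have := hy.1
            gcongr
      _ = ENNReal.ofReal (1 / (2 ^ j * R) ^ (n + η)) *
          G {y | 2 ^ j * R ≤ ‖x - y‖ ∧ ‖x - y‖ < 2 ^ (j + 1) * R} := setLIntegral_const _ _
      _ ≤ ENNReal.ofReal (1 / (2 ^ j * R) ^ (n + η)) *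
          ENNReal.ofReal (a * (2 ^ (j + 1) * R) ^ n) := by
          refine mul_le_mul_right ((measure_mono fun y hy => ?_).trans (hG _ (by positivity))) _
          rw [mem_closedBall_iff_norm']
          exact hy.2.le
      _ = _ := by
          rw [← ENNReal.ofReal_mul (by positivity)]
          congr 1
          rw [Real.rpow_add hj, pow_succ, mul_right_comm, Real.mul_rpow hj.le (by norm_num),
            Real.mul_rpow (z := η) (by positivity) hR.le, ← Real.rpow_natCast_mul (by norm_num),
            mul_comm (j : ℝ), Real.rpow_mul_natCast (by norm_num)]
          have : 0 < (2 ^ j * R) ^ n := by positivity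
          rw [inv_pow]
          field_simp
  calc _ ≤ ∫⁻ y in ⋃ j : ℕ, {y | 2 ^ j * R ≤ ‖x - y‖ ∧ ‖x - y‖ < 2 ^ (j + 1) * R},
        ENNReal.ofReal (1 / ‖x - y‖ ^ (n + η)) ∂G := lintegral_mono_set hcov
    _ ≤ ∑' j : ℕ, ∫⁻ y in {y | 2 ^ j * R ≤ ‖x - y‖ ∧ ‖x - y‖ < 2 ^ (j + 1) * R},
        ENNReal.ofReal (1 / ‖x - y‖ ^ (n + η)) ∂G := lintegral_iUnion_le _ _
    _ ≤ ∑' j : ℕ, ENNReal.ofReal (2 ^ n * a / R ^ η * ((2 ^ η)⁻¹) ^ j) :=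
        ENNReal.tsum_le_tsum hterm
    _ = _ := by
        rw [← ENNReal.ofReal_tsum_of_nonneg (fun j => by positivity)
          ((summable_geometric_of_lt_one (by positivity) h2').mul_left _), tsum_mul_left,
          tsum_geometric_of_lt_one (by positivity) h2']
        congr 1
        have : 0 < 1 - (2 ^ η : ℝ)⁻¹ := by linarith
        field_simp

/-- An `n`-AD-regular measure has `n`-growth, except possibly if its support is a singleton. -/
theorem IsADRegular.hasGrowth {d : ℕ} {n : ℝ} (hn : 0 ≤ n) {μ : Measure (Eu d)}
    (hμ : IsADRegular n μ) (hpt : ∀ a, μ.support ≠ {a}) : HasGrowth n μ := by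
  obtain ⟨c, hc, h⟩ := hμ
  refine ⟨c * 2 ^ n, by positivity, fun x r hr => ?_⟩
  by_cases hx : μ (Metric.closedBall x r) = 0
  · rw [hx]; exact zero_le
  obtain ⟨z, hz, hzK⟩ := Measure.nonempty_inter_support_of_pos (pos_iff_ne_zero.2 hx)
  have hle : c * (2 * r) ^ n ≤ c * 2 ^ n * r ^ n := by
    rw [Real.mul_rpow (by norm_num) hr.le, mul_assoc]
  -- A ball meeting the support at `z` lies in `B(z, 2r)`, to which regularity applies if `2r` is an
  -- admissible radius. Otherwise the ball of radius `D`, the diameter, around `z` already carries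
  -- all the mass; `D` is positive because the support is not a point.
  by_cases hd : ENNReal.ofReal (2 * r) ≤ Metric.ediam μ.support
  · refine (measure_mono ?_).trans ((h z hzK (2 * r) (by positivity) hd).2.trans
      (ENNReal.ofReal_le_ofReal hle))
    refine Metric.closedBall_subset_closedBall' ?_
    rw [Metric.mem_closedBall, dist_comm] at hz
    linarith
  · push Not at hd
    have hfin : Metric.ediam μ.support ≠ ∞ := hd.ne_top
    set D := (Metric.ediam μ.support).toReal with hD
    have hDe : ENNReal.ofReal D = Metric.ediam μ.support := ENNReal.ofReal_toReal hfin
    have hD0 : 0 < D := by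
      refine ENNReal.toReal_pos (fun h0 => ?_) hfin
      rw [Metric.ediam_eq_zero_iff] at h0
      obtain h0 | ⟨a, ha⟩ := h0.eq_empty_or_singleton
      · simp [h0] at hzK
      · exact hpt a ha
    have hDr : D ≤ 2 * r := by
      rw [← hDe] at hd
      exact ((ENNReal.ofReal_lt_ofReal_iff (by positivity)).1 hd).le
    calc μ (Metric.closedBall x r) ≤ μ (Metric.closedBall z D ∪ μ.supportᶜ) := by
          refine measure_mono fun y _ => ?_
          by_cases hy : y ∈ μ.support
          · left
            rw [Metric.mem_closedBall, ← ENNReal.ofReal_le_ofReal_iff hD0.le, hDe, ← edist_dist]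
            exact Metric.edist_le_ediam_of_mem hy hzK
          · exact Or.inr hy
      _ ≤ μ (Metric.closedBall z D) + μ μ.supportᶜ := measure_union_le _ _
      _ = μ (Metric.closedBall z D) := by rw [Measure.measure_compl_support, add_zero]
      _ ≤ ENNReal.ofReal (c * D ^ n) := (h z hzK D hD0 hDe.le).2
      _ ≤ _ := ENNReal.ofReal_le_ofReal (le_trans (by gcongr) hle)

/-! ### Calderón-Zygmund kernels, their truncations and cancellation. -/

/-- Quantitative one-variable form of the Calderón-Zygmund conditions. -/
structure CZBound {d : ℕ} (n c η : ℝ) (k : Eu d → Eu d → ℂ) : Prop where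
  c_pos : 0 < c
  eta_pos : 0 < η
  size : ∀ x y, x ≠ y → ‖k x y‖ ≤ c / ‖x - y‖ ^ n
  smooth_left : ∀ x y x', x ≠ y → ‖x - x'‖ ≤ ‖x - y‖ / 2 →
    ‖k x y - k x' y‖ ≤ c * ‖x - x'‖ ^ η / ‖x - y‖ ^ (n + η)
  smooth_right : ∀ x y y', x ≠ y → ‖y - y'‖ ≤ ‖x - y‖ / 2 →
    ‖k x y - k x y'‖ ≤ c * ‖y - y'‖ ^ η / ‖x - y‖ ^ (n + η)

theorem IsCZKernel.exists_czBound {d : ℕ} {n : ℝ} {k : Eu d → Eu d → ℂ} (hk : IsCZKernel n k) :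
    ∃ c η, CZBound n c η k := by
  obtain ⟨c, η, hc, hη, -, h1, h2⟩ := hk
  refine ⟨c, η, hc, hη, h1, fun x y x' hxy h => ?_, fun x y y' hxy h => ?_⟩
  · exact (le_add_of_nonneg_right (norm_nonneg _)).trans (h2 x y x' hxy h)
  · rw [norm_sub_rev x y] at h ⊢
    exact (le_add_of_nonneg_left (norm_nonneg _)).trans (h2 y x y' hxy.symm h)

theorem CZBound.swap {d : ℕ} {n c η : ℝ} {k : Eu d → Eu d → ℂ} (hk : CZBound n c η k) :
    CZBound n c η fun x y => k y x := by
  refine ⟨hk.c_pos, hk.eta_pos, fun x y hxy => ?_, fun x y x' hxy h => ?_,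
    fun x y y' hxy h => ?_⟩
  · rw [norm_sub_rev]
    exact hk.size y x hxy.symm
  · rw [norm_sub_rev x y] at h ⊢
    exact hk.smooth_right y x x' hxy.symm h
  · rw [norm_sub_rev x y] at h ⊢
    exact hk.smooth_left y x y' hxy.symm h

/-- The kernel is not assumed measurable. Hölder smoothness in each variable gives joint continuity
off the diagonal by moving one variable at a time, and this is the source of every measurability
statement below. -/
theorem CZBound.continuousOn {d : ℕ} {n c η : ℝ} {k : Eu d → Eu d → ℂ} (hk : CZBound n c η k) :
    ContinuousOn (Function.uncurry k) {p : Eu d × Eu d | p.1 ≠ p.2} := by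
  rintro ⟨x₀, y₀⟩ hp
  have hxy : x₀ ≠ y₀ := hp
  refine ContinuousAt.continuousWithinAt ?_
  have hpos : 0 < ‖x₀ - y₀‖ := norm_pos_iff.2 (sub_ne_zero.2 hxy)
  rw [ContinuousAt, tendsto_iff_norm_sub_tendsto_zero]
  set B : Eu d × Eu d → ℝ := fun p => c * ‖y₀ - p.2‖ ^ η / ‖p.1 - y₀‖ ^ (n + η) +
    c * ‖x₀ - p.1‖ ^ η / ‖x₀ - y₀‖ ^ (n + η) with hB
  have hη := hk.eta_pos
  have hB0 : Filter.Tendsto B (nhds (x₀, y₀)) (nhds 0) := by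
    have hcont : ContinuousAt B (x₀, y₀) := by
      refine ContinuousAt.add (ContinuousAt.div ?_ ?_ ?_) (ContinuousAt.div ?_ ?_ ?_)
      · exact continuousAt_const.mul (ContinuousAt.rpow_const (by fun_prop) (Or.inr hη.le))
      · exact ContinuousAt.rpow_const (by fun_prop) (Or.inl hpos.ne')
      · exact (Real.rpow_pos_of_pos hpos _).ne'
      · exact continuousAt_const.mul (ContinuousAt.rpow_const (by fun_prop) (Or.inr hη.le))
      · exact continuousAt_const
      · exact (Real.rpow_pos_of_pos hpos _).ne'
    have h0 : B (x₀, y₀) = 0 := by simp [hB, Real.zero_rpow hη.ne']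
    rw [← h0]
    exact hcont.tendsto
  refine squeeze_zero' (Filter.Eventually.of_forall fun _ => norm_nonneg _) ?_ hB0
  have e1 : ∀ᶠ p : Eu d × Eu d in nhds (x₀, y₀), 0 < ‖p.1 - y₀‖ := by
    refine ContinuousAt.eventually_lt continuousAt_const (by fun_prop) ?_
    simpa using hpos
  have e2 : ∀ᶠ p : Eu d × Eu d in nhds (x₀, y₀), ‖x₀ - p.1‖ < ‖x₀ - y₀‖ / 2 := by
    refine ContinuousAt.eventually_lt (by fun_prop) continuousAt_const ?_
    simpa using hpos
  have e3 : ∀ᶠ p : Eu d × Eu d in nhds (x₀, y₀), ‖y₀ - p.2‖ < ‖p.1 - y₀‖ / 2 := by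
    refine ContinuousAt.eventually_lt (by fun_prop) (by fun_prop) ?_
    simpa using hpos
  filter_upwards [e1, e2, e3] with p h1 h2 h3
  have hne : p.1 ≠ y₀ := sub_ne_zero.1 (norm_pos_iff.1 h1)
  calc ‖Function.uncurry k p - Function.uncurry k (x₀, y₀)‖
      = ‖-(k p.1 y₀ - k p.1 p.2) + -(k x₀ y₀ - k p.1 y₀)‖ := by
        congr 1
        simp only [Function.uncurry]
        ring
    _ ≤ ‖k p.1 y₀ - k p.1 p.2‖ + ‖k x₀ y₀ - k p.1 y₀‖ :=
        (norm_add_le _ _).trans_eq (by rw [norm_neg, norm_neg])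
    _ ≤ B p := add_le_add (hk.smooth_right _ _ _ hne h3.le) (hk.smooth_left _ _ _ hxy h2.le)

/-- The kernel `k(x,y)` cut off to `|x-y| > ε`. -/
noncomputable def truncKernel {d : ℕ} (k : Eu d → Eu d → ℂ) (ε : ℝ) (x y : Eu d) : ℂ :=
  Set.indicator {y | ε < ‖x - y‖} (fun y => k x y) y

theorem truncKernel_of_lt {d : ℕ} {k : Eu d → Eu d → ℂ} {ε : ℝ} {x y : Eu d} (h : ε < ‖x - y‖) :
    truncKernel k ε x y = k x y := Set.indicator_of_mem (s := {y | ε < ‖x - y‖}) h _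

theorem truncKernel_of_le {d : ℕ} {k : Eu d → Eu d → ℂ} {ε : ℝ} {x y : Eu d} (h : ‖x - y‖ ≤ ε) :
    truncKernel k ε x y = 0 :=
  Set.indicator_of_notMem (s := {y | ε < ‖x - y‖}) (fun h' => absurd h' (not_lt.2 h)) _

theorem truncKernel_swap {d : ℕ} (k : Eu d → Eu d → ℂ) (ε : ℝ) (x y : Eu d) :
    truncKernel (fun x y => k y x) ε x y = truncKernel k ε y x := by
  rcases lt_or_ge ε ‖x - y‖ with h | h
  · rw [truncKernel_of_lt h, truncKernel_of_lt (by rwa [norm_sub_rev])]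
  · rw [truncKernel_of_le h, truncKernel_of_le (by rwa [norm_sub_rev])]

theorem measurableSet_far {d : ℕ} (ε : ℝ) (x : Eu d) : MeasurableSet {y | ε < ‖x - y‖} :=
  measurableSet_lt measurable_const (by fun_prop)

theorem truncOp_eq_integral {d : ℕ} (k : Eu d → Eu d → ℂ) (ν : Measure (Eu d)) (ε : ℝ)
    (f : Eu d → ℂ) (x : Eu d) : truncOp k ν ε f x = ∫ y, truncKernel k ε x y * f y ∂ν := by
  rw [truncOp, ← integral_indicator (measurableSet_far ε x)]
  congr 1
  ext y
  simp only [truncKernel, Set.indicator]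
  split_ifs <;> simp

section
variable {d : ℕ} {n c η : ℝ} {k : Eu d → Eu d → ℂ}

theorem CZBound.measurable_truncKernel (hk : CZBound n c η k) {ε : ℝ} (hε : 0 < ε) :
    Measurable (Function.uncurry (truncKernel k ε)) := by
  classical
  have hs : MeasurableSet {p : Eu d × Eu d | ε < ‖p.1 - p.2‖} :=
    measurableSet_lt measurable_const (by fun_prop)
  have : Function.uncurry (truncKernel k ε) =
      Set.piecewise {p : Eu d × Eu d | ε < ‖p.1 - p.2‖} (Function.uncurry k) (fun _ => 0) := by
    ext ⟨x, y⟩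
    simp [truncKernel, Set.indicator, Set.piecewise, Function.uncurry]
  rw [this]
  refine ContinuousOn.measurable_piecewise (hk.continuousOn.mono ?_) continuousOn_const hs
  intro p hp hxy
  rw [Set.mem_ofPred_eq, hxy, sub_self, norm_zero] at hp
  linarith

theorem CZBound.measurable_truncKernel_right (hk : CZBound n c η k) {ε : ℝ} (hε : 0 < ε)
    (x : Eu d) : Measurable (truncKernel k ε x) :=
  (hk.measurable_truncKernel hε).of_uncurry_left

theorem CZBound.norm_truncKernel_le (hk : CZBound n c η k) {ε : ℝ} (hε : 0 < ε)
    (x y : Eu d) : ‖truncKernel k ε x y‖ ≤ c / ‖x - y‖ ^ n := by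
  have := hk.c_pos
  rcases lt_or_ge ε ‖x - y‖ with h | h
  · rw [truncKernel_of_lt h]
    exact hk.size _ _ (sub_ne_zero.1 (norm_pos_iff.1 (hε.trans h)))
  · rw [truncKernel_of_le h, norm_zero]
    positivity

theorem CZBound.norm_truncKernel_le_const (hk : CZBound n c η k) (hn : 0 ≤ n) {ε : ℝ}
    (hε : 0 < ε) (x y : Eu d) : ‖truncKernel k ε x y‖ ≤ c / ε ^ n := by
  have := hk.c_pos
  rcases lt_or_ge ε ‖x - y‖ with h | h
  · exact (hk.norm_truncKernel_le hε x y).trans (by gcongr)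
  · rw [truncKernel_of_le h, norm_zero]
    positivity

/-- Smoothness of the truncated kernel, with an error where the cut-off is felt. -/
theorem CZBound.norm_truncKernel_sub_le (hk : CZBound n c η k) (hn : 0 ≤ n) {ε ρ : ℝ}
    (hε : 0 < ε) (hρ : 0 < ρ) {x y a : Eu d} (hy : ‖a - y‖ ≤ ρ) (hx : 2 * ρ ≤ ‖a - x‖) :
    ‖truncKernel k ε x y - truncKernel k ε x a‖ ≤ c * ρ ^ η * (1 / ‖a - x‖ ^ (n + η)) +
      (Metric.closedBall a (2 * ε)).indicator (fun _ => c / ε ^ n) x := by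
  have hc := hk.c_pos
  have hη := hk.eta_pos
  have h1 : 0 ≤ c * ρ ^ η * (1 / ‖a - x‖ ^ (n + η)) := by positivity
  have h2 : 0 ≤ (Metric.closedBall a (2 * ε)).indicator (fun _ => c / ε ^ n) x :=
    Set.indicator_nonneg (fun _ _ => by positivity) _
  have htri : ‖a - x‖ ≤ ‖a - y‖ + ‖x - y‖ := by
    rw [norm_sub_rev x y]
    exact norm_sub_le_norm_sub_add_norm_sub a y x
  have hin : ‖a - x‖ ≤ 2 * ε → (Metric.closedBall a (2 * ε)).indicator (fun _ => c / ε ^ n) x =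
      c / ε ^ n := fun h =>
    Set.indicator_of_mem (by rw [mem_closedBall_iff_norm']; exact h) _
  -- If the cut-off separates `y` from `a`, then `‖a - x‖ ≤ 2ε`: this is immediate when `a` is the
  -- near point, and otherwise `‖a - x‖ ≤ ρ + ε ≤ ‖a - x‖ / 2 + ε`. The indicator term then absorbs
  -- the single surviving kernel value.
  rcases lt_or_ge ε ‖x - y‖ with hxy | hxy <;> rcases lt_or_ge ε ‖x - a‖ with hxa | hxa
  · rw [truncKernel_of_lt hxy, truncKernel_of_lt hxa, norm_sub_rev]
    have hne : x ≠ a := sub_ne_zero.1 (norm_pos_iff.1 (hε.trans hxa))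
    have hs := hk.smooth_right x a y hne (by rw [norm_sub_rev x a]; linarith)
    rw [norm_sub_rev x a] at hs
    have : c * ‖a - y‖ ^ η / ‖a - x‖ ^ (n + η) ≤ c * ρ ^ η * (1 / ‖a - x‖ ^ (n + η)) := by
      rw [mul_one_div]
      gcongr
    linarith
  · rw [truncKernel_of_le hxa, sub_zero, hin (by rw [norm_sub_rev]; linarith)]
    linarith [hk.norm_truncKernel_le_const hn hε x y]
  · rw [truncKernel_of_le hxy, zero_sub, norm_neg, hin (by linarith)]
    linarith [hk.norm_truncKernel_le_const hn hε x a]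
  · rw [truncKernel_of_le hxa, truncKernel_of_le hxy, sub_zero, norm_zero]
    linarith

theorem CZBound.integrable_truncKernel (hk : CZBound n c η k) (hn : 0 ≤ n) {ε : ℝ}
    (hε : 0 < ε) (x : Eu d) (τ : Measure (Eu d)) [IsFiniteMeasure τ] :
    Integrable (truncKernel k ε x) τ :=
  Integrable.of_bound (hk.measurable_truncKernel_right hε x).aestronglyMeasurable _
    (Filter.Eventually.of_forall fun y => hk.norm_truncKernel_le_const hn hε x y)

/-- Far from a small ball, a measure on it acts like a point mass at the centre; integrating the
pointwise kernel difference quantifies this. -/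
theorem CZBound.enorm_integral_truncKernel_sub_le (hk : CZBound n c η k) (hn : 0 ≤ n) {ε ρ : ℝ}
    (hε : 0 < ε) (hρ : 0 < ρ) {x a : Eu d} (hx : 2 * ρ ≤ ‖a - x‖)
    (τ : Measure (Eu d)) [IsFiniteMeasure τ] (hτ : ∀ᵐ y ∂τ, ‖a - y‖ ≤ ρ) :
    ‖(∫ y, truncKernel k ε x y ∂τ) - τ.real Set.univ * truncKernel k ε x a‖ₑ ≤
      ENNReal.ofReal (c * ρ ^ η * (1 / ‖a - x‖ ^ (n + η)) +
        (Metric.closedBall a (2 * ε)).indicator (fun _ => c / ε ^ n) x) * τ Set.univ := by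
  have : (τ.real Set.univ : ℂ) * truncKernel k ε x a = ∫ _, truncKernel k ε x a ∂τ := by
    rw [integral_const, Complex.real_smul]
  rw [this, ← integral_sub (hk.integrable_truncKernel hn hε x τ) (integrable_const _)]
  refine (enorm_integral_le_lintegral_enorm _).trans ?_
  rw [← lintegral_const]
  refine lintegral_mono_ae ?_
  filter_upwards [hτ] with y hy
  rw [← ofReal_norm]
  exact ENNReal.ofReal_le_ofReal (hk.norm_truncKernel_sub_le hn hε hρ hy hx)

/-- Cancellation estimate: two measures of equal mass on a ball have truncated potentials that
are close in `L^1` away from the ball. -/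
theorem CZBound.lintegral_enorm_sub_le (hk : CZBound n c η k) (hn : 0 < n) {cν : ℝ}
    (hcν : 0 < cν) {ν : Measure (Eu d)}
    (hν : ∀ (x : Eu d) (r : ℝ), 0 < r → ν (Metric.closedBall x r) ≤ ENNReal.ofReal (cν * r ^ n)) :
    ∃ C : ℝ, 0 ≤ C ∧ ∀ (ε ρ : ℝ) (a : Eu d) (τ γ : Measure (Eu d)), 0 < ε → 0 < ρ →
      IsFiniteMeasure τ → IsFiniteMeasure γ → τ Set.univ = γ Set.univ →
      (∀ᵐ y ∂τ, ‖a - y‖ ≤ ρ) → (∀ᵐ y ∂γ, ‖a - y‖ ≤ ρ) →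
      ∫⁻ x in {x | 2 * ρ ≤ ‖a - x‖},
        ‖(∫ y, truncKernel k ε x y ∂τ) - ∫ y, truncKernel k ε x y ∂γ‖ₑ ∂ν ≤
          ENNReal.ofReal C * τ Set.univ := by
  have hc := hk.c_pos
  have hη := hk.eta_pos
  have h2 : 0 < 1 - (2 ^ η : ℝ)⁻¹ :=
    sub_pos.2 (inv_lt_one_of_one_lt₀ (Real.one_lt_rpow (by norm_num) hη))
  refine ⟨2 * (c * (2 ^ n / (1 - (2 ^ η)⁻¹) * cν / 2 ^ η) + c * (cν * 2 ^ n)), by positivity,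
    fun ε ρ a τ γ hε hρ _ _ hm hτ hγ => ?_⟩
  set F : Eu d → ℝ := fun x => c * ρ ^ η * (1 / ‖a - x‖ ^ (n + η)) +
        (Metric.closedBall a (2 * ε)).indicator (fun _ => c / ε ^ n) x with hF
  have hpt : ∀ x ∈ {x | 2 * ρ ≤ ‖a - x‖},
      ‖(∫ y, truncKernel k ε x y ∂τ) - ∫ y, truncKernel k ε x y ∂γ‖ₑ ≤
        ENNReal.ofReal (F x) * (2 * τ Set.univ) := fun x hx => by
    have h1 := hk.enorm_integral_truncKernel_sub_le hn.le hε hρ hx τ hτ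
    have h2 := hk.enorm_integral_truncKernel_sub_le hn.le hε hρ hx γ hγ
    -- Equal masses give both measures the same point-mass approximation at `a`, so it drops out of
    -- the difference.
    rw [← hm, Measure.real, ← hm, ← Measure.real] at h2
    calc _ = ‖((∫ y, truncKernel k ε x y ∂τ) - τ.real Set.univ * truncKernel k ε x a) -
          ((∫ y, truncKernel k ε x y ∂γ) - τ.real Set.univ * truncKernel k ε x a)‖ₑ := by
          rw [sub_sub_sub_cancel_right]
      _ ≤ _ := enorm_sub_le
      _ ≤ _ := add_le_add h1 h2
      _ = _ := by rw [← two_mul]; ring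
  have hms : MeasurableSet {x | 2 * ρ ≤ ‖a - x‖} :=
    measurableSet_le measurable_const (by fun_prop)
  -- The bound does not depend on `ρ` or `ε`: the tail integral over `‖a - x‖ ≥ 2ρ` decays like `ρ ^
  -- (-η)`, and the cut-off term is `c / ε ^ n` on a ball of `ν`-mass at most `cν * (2 * ε) ^ n`.
  have hFint : ∫⁻ x in {x | 2 * ρ ≤ ‖a - x‖}, ENNReal.ofReal (F x) ∂ν ≤
      ENNReal.ofReal (c * (2 ^ n / (1 - (2 ^ η)⁻¹) * cν / 2 ^ η) + c * (cν * 2 ^ n)) := by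
    calc _ = ∫⁻ x in {x | 2 * ρ ≤ ‖a - x‖}, (ENNReal.ofReal (c * ρ ^ η) *
          ENNReal.ofReal (1 / ‖a - x‖ ^ (n + η)) +
          (Metric.closedBall a (2 * ε)).indicator (fun _ => ENNReal.ofReal (c / ε ^ n)) x) ∂ν := by
          refine lintegral_congr fun x => ?_
          rw [hF, ENNReal.ofReal_add (by positivity)
            (Set.indicator_nonneg (fun _ _ => by positivity) _),
            ENNReal.ofReal_mul (by positivity)]
          congr 1
          by_cases hx : x ∈ Metric.closedBall a (2 * ε)
          · rw [Set.indicator_of_mem hx, Set.indicator_of_mem hx]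
          · rw [Set.indicator_of_notMem hx, Set.indicator_of_notMem hx, ENNReal.ofReal_zero]
      _ = ENNReal.ofReal (c * ρ ^ η) *
            (∫⁻ x in {x | 2 * ρ ≤ ‖a - x‖}, ENNReal.ofReal (1 / ‖a - x‖ ^ (n + η)) ∂ν) +
          ∫⁻ x in {x | 2 * ρ ≤ ‖a - x‖},
            (Metric.closedBall a (2 * ε)).indicator (fun _ => ENNReal.ofReal (c / ε ^ n)) x ∂ν := by
          rw [lintegral_add_left (by fun_prop), lintegral_const_mul _ (by fun_prop)]
      _ ≤ ENNReal.ofReal (c * ρ ^ η) *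
            ENNReal.ofReal (2 ^ n / (1 - (2 ^ η)⁻¹) * cν / (2 * ρ) ^ η) +
          ENNReal.ofReal (c / ε ^ n) * ENNReal.ofReal (cν * (2 * ε) ^ n) := by
          refine add_le_add (mul_le_mul_right
            (lintegral_tail_le hn hη hcν.le (by positivity) (hν a)) _) ?_
          refine (setLIntegral_le_lintegral _ _).trans ?_
          rw [lintegral_indicator_const Metric.isClosed_closedBall.measurableSet]
          exact mul_le_mul_right (hν a _ (by positivity)) _
      _ = _ := by
          rw [← ENNReal.ofReal_mul (by positivity), ← ENNReal.ofReal_mul (by positivity),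
            ← ENNReal.ofReal_add (by positivity) (by positivity)]
          congr 1
          rw [Real.mul_rpow (by norm_num) hρ.le, Real.mul_rpow (by norm_num) hε.le]
          have := Real.rpow_pos_of_pos hρ η
          have := Real.rpow_pos_of_pos hε n
          field_simp
  calc _ ≤ ∫⁻ x in {x | 2 * ρ ≤ ‖a - x‖}, ENNReal.ofReal (F x) * (2 * τ Set.univ) ∂ν :=
        setLIntegral_mono' hms hpt
    _ = (∫⁻ x in {x | 2 * ρ ≤ ‖a - x‖}, ENNReal.ofReal (F x) ∂ν) * (2 * τ Set.univ) :=
        lintegral_mul_const' _ _ (by finiteness)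
    _ ≤ _ := by
        refine (mul_le_mul_left hFint _).trans_eq ?_
        rw [ENNReal.ofReal_mul (by norm_num), ENNReal.ofReal_ofNat]
        ring

end

/-! ### Hölder estimates and truncated operators on `L^p`. -/

theorem eLpNorm_ofReal_rpow {α : Type*} [MeasurableSpace α] {μ : Measure α} {p : ℝ} (hp : 0 < p)
    (f : α → ℂ) : eLpNorm f (ENNReal.ofReal p) μ ^ p = ∫⁻ x, ‖f x‖ₑ ^ p ∂μ := by
  rw [eLpNorm_eq_lintegral_rpow_enorm_toReal (by simpa using hp) ENNReal.ofReal_ne_top,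
    ENNReal.toReal_ofReal hp.le, ← ENNReal.rpow_mul, one_div, inv_mul_cancel₀ hp.ne',
    ENNReal.rpow_one]

theorem memLp_ofReal_iff {α : Type*} [MeasurableSpace α] {μ : Measure α} {p : ℝ} (hp : 0 < p)
    {f : α → ℂ} : MemLp f (ENNReal.ofReal p) μ ↔
      AEStronglyMeasurable f μ ∧ ∫⁻ x, ‖f x‖ₑ ^ p ∂μ < ∞ := by
  rw [MemLp, ← eLpNorm_ofReal_rpow hp, ENNReal.rpow_lt_top_iff_of_pos hp]

/-- Hölder's inequality on a set. -/
theorem setLIntegral_le_of_rpow_le {α : Type*} [MeasurableSpace α] {μ : Measure α} {q : ℝ}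
    (hq : 1 < q) {g : α → ℝ≥0∞} {B : Set α} (hg : AEMeasurable g (μ.restrict B)) {A b s : ℝ}
    (hA : 0 ≤ A) (hb : 0 ≤ b) (hs : 0 < s) (hgB : ∫⁻ x in B, g x ^ q ∂μ ≤ ENNReal.ofReal (A * s))
    (hB : μ B ≤ ENNReal.ofReal (b * s)) :
    ∫⁻ x in B, g x ∂μ ≤ ENNReal.ofReal (A ^ (1 / q) * b ^ (1 - 1 / q) * s) := by
  have hconj := Real.HolderConjugate.conjExponent hq
  have hq0 : 0 < q := by linarith
  have h1 : 0 ≤ 1 - 1 / q := by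
    rw [sub_nonneg, div_le_one hq0]
    exact hq.le
  have hq' : 1 / q.conjExponent = 1 - 1 / q := by
    have := hconj.inv_add_inv_eq_one
    rw [one_div, one_div]
    linarith
  have key := ENNReal.lintegral_mul_le_Lp_mul_Lq (μ.restrict B) hconj hg
    (aemeasurable_const (b := (1 : ℝ≥0∞)))
  simp only [Pi.mul_apply, mul_one, ENNReal.one_rpow, lintegral_const, one_mul,
    Measure.restrict_apply_univ, hq'] at key
  refine key.trans ?_
  calc _ ≤ ENNReal.ofReal (A * s) ^ (1 / q) * ENNReal.ofReal (b * s) ^ (1 - 1 / q) := by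
        gcongr
    _ = _ := by
        rw [ENNReal.ofReal_rpow_of_nonneg (by positivity) (by positivity),
          ENNReal.ofReal_rpow_of_nonneg (by positivity) h1, ← ENNReal.ofReal_mul (by positivity),
          Real.mul_rpow hA hs.le, Real.mul_rpow hb hs.le]
        congr 1
        have : s ^ (1 / q) * s ^ (1 - 1 / q) = s := by
          rw [← Real.rpow_add hs]
          simp
        calc _ = A ^ (1 / q) * b ^ (1 - 1 / q) * (s ^ (1 / q) * s ^ (1 - 1 / q)) := by ring
          _ = _ := by rw [this]

section
variable {d : ℕ} {n c η : ℝ} {k : Eu d → Eu d → ℂ}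

/-- The truncated kernel is uniformly in the dual of `L^p` of a measure with `n`-growth. -/
theorem CZBound.lintegral_truncKernel_mul_le (hk : CZBound n c η k) (hn : 0 < n)
    {ν : Measure (Eu d)} (hν : HasGrowth n ν) {p : ℝ} (hp : 1 ≤ p) {ε : ℝ} (hε : 0 < ε) :
    ∃ M : ℝ≥0∞, M ≠ ∞ ∧ ∀ (x : Eu d) (f : Eu d → ℂ), AEStronglyMeasurable f ν →
      ∫⁻ y, ‖truncKernel k ε x y * f y‖ₑ ∂ν ≤ M * eLpNorm f (ENNReal.ofReal p) ν := by
  have hc := hk.c_pos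
  obtain ⟨cν, hcν, hν⟩ := hν
  simp_rw [enorm_mul]
  rcases hp.eq_or_lt with rfl | hp1
  · refine ⟨ENNReal.ofReal (c / ε ^ n), ENNReal.ofReal_ne_top, fun x f hf => ?_⟩
    rw [ENNReal.ofReal_one, eLpNorm_one_eq_lintegral_enorm,
      ← lintegral_const_mul' _ _ ENNReal.ofReal_ne_top]
    refine lintegral_mono fun y => mul_le_mul_left ?_ _
    rw [← ofReal_norm]
    exact ENNReal.ofReal_le_ofReal (hk.norm_truncKernel_le_const hn.le hε x y)
  have hconj := (Real.HolderConjugate.conjExponent hp1).symm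
  set p' := p.conjExponent
  have hp' : 1 < p' := hconj.lt
  have hp0 : 0 < p := by linarith
  have hp'0 : 0 < p' := by linarith
  -- The `p'`-th power of the kernel decays with exponent `n * p' = n + n * (p' - 1)`, so the tail
  -- estimate applies with `n * (p' - 1)` in the role of `η`.
  have hη' : 0 < n * (p' - 1) := mul_pos hn (by linarith)
  refine ⟨(ENNReal.ofReal (c ^ p') * ENNReal.ofReal (2 ^ n / (1 - (2 ^ (n * (p' - 1)))⁻¹) * cν /
    ε ^ (n * (p' - 1)))) ^ (1 / p'), by finiteness, fun x f hf => ?_⟩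
  have hKm := hk.measurable_truncKernel_right hε x
  refine (ENNReal.lintegral_mul_le_Lp_mul_Lq ν hconj hKm.enorm.aemeasurable hf.enorm).trans ?_
  rw [eLpNorm_eq_lintegral_rpow_enorm_toReal (by simpa using hp0) ENNReal.ofReal_ne_top,
    ENNReal.toReal_ofReal hp0.le]
  refine mul_le_mul_left (ENNReal.rpow_le_rpow ?_ (by positivity)) _
  have hms : MeasurableSet {y | ε ≤ ‖x - y‖} :=
    measurableSet_le measurable_const (by fun_prop)
  calc ∫⁻ y, ‖truncKernel k ε x y‖ₑ ^ p' ∂ν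
      ≤ ∫⁻ y, Set.indicator {y | ε ≤ ‖x - y‖} (fun y => ENNReal.ofReal (c ^ p') *
          ENNReal.ofReal (1 / ‖x - y‖ ^ (n + n * (p' - 1)))) y ∂ν := by
        refine lintegral_mono fun y => ?_
        rcases lt_or_ge ε ‖x - y‖ with h | h
        · rw [Set.indicator_of_mem (show y ∈ {y | ε ≤ ‖x - y‖} from h.le),
            ← ENNReal.ofReal_mul (by positivity), ← ofReal_norm,
            ENNReal.ofReal_rpow_of_nonneg (norm_nonneg _) hp'0.le]
          refine ENNReal.ofReal_le_ofReal ?_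
          calc _ ≤ (c / ‖x - y‖ ^ n) ^ p' :=
                Real.rpow_le_rpow (norm_nonneg _) (hk.norm_truncKernel_le hε x y) hp'0.le
            _ = _ := by
                rw [Real.div_rpow hc.le (by positivity), ← Real.rpow_mul (norm_nonneg _),
                  mul_one_div]
                congr 2
                ring
        · rw [truncKernel_of_le h, enorm_zero, ENNReal.zero_rpow_of_pos hp'0]
          exact zero_le
    _ = ENNReal.ofReal (c ^ p') *
          ∫⁻ y in {y | ε ≤ ‖x - y‖}, ENNReal.ofReal (1 / ‖x - y‖ ^ (n + n * (p' - 1))) ∂ν := by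
        rw [lintegral_indicator hms, lintegral_const_mul _ (by fun_prop)]
    _ ≤ _ := mul_le_mul_right (lintegral_tail_le hn hη' hcν.le hε (hν x)) _

theorem CZBound.integrable_truncKernel_mul (hk : CZBound n c η k) (hn : 0 < n)
    {ν : Measure (Eu d)} (hν : HasGrowth n ν) {p : ℝ} (hp : 1 ≤ p) {ε : ℝ} (hε : 0 < ε)
    {f : Eu d → ℂ} (hf : MemLp f (ENNReal.ofReal p) ν) (x : Eu d) :
    Integrable (fun y => truncKernel k ε x y * f y) ν := by
  obtain ⟨M, hM, h⟩ := hk.lintegral_truncKernel_mul_le hn hν hp hε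
  refine ⟨(hk.measurable_truncKernel_right hε x).aestronglyMeasurable.mul hf.1, ?_⟩
  exact (h x f hf.1).trans_lt (ENNReal.mul_lt_top hM.lt_top hf.2)

theorem truncOp_congr_ae {ν : Measure (Eu d)} {ε : ℝ} {f g : Eu d → ℂ} (h : f =ᵐ[ν] g) :
    truncOp k ν ε f = truncOp k ν ε g := by
  ext x
  rw [truncOp_eq_integral, truncOp_eq_integral]
  refine integral_congr_ae ?_
  filter_upwards [h] with y hy
  rw [hy]

theorem CZBound.measurable_truncOp (hk : CZBound n c η k) {ν : Measure (Eu d)} [SFinite ν]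
    {ε : ℝ} (hε : 0 < ε) {f : Eu d → ℂ} (hf : AEStronglyMeasurable f ν) :
    Measurable (truncOp k ν ε f) := by
  rw [truncOp_congr_ae hf.ae_eq_mk]
  have : truncOp k ν ε (hf.mk f) = fun x => ∫ y, truncKernel k ε x y * hf.mk f y ∂ν :=
    funext fun x => truncOp_eq_integral _ _ _ _ _
  rw [this]
  have hm : StronglyMeasurable
      (Function.uncurry fun x y => truncKernel k ε x y * hf.mk f y) := by
    refine Measurable.stronglyMeasurable ?_
    exact (hk.measurable_truncKernel hε).mul (hf.stronglyMeasurable_mk.measurable.comp measurable_snd)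
  exact hm.integral_prod_right.measurable

theorem CZBound.truncOp_add (hk : CZBound n c η k) (hn : 0 < n)
    {ν : Measure (Eu d)} (hν : HasGrowth n ν) {p q : ℝ} (hp : 1 ≤ p) (hq : 1 ≤ q) {ε : ℝ}
    (hε : 0 < ε) {f g : Eu d → ℂ} (hf : MemLp f (ENNReal.ofReal p) ν)
    (hg : MemLp g (ENNReal.ofReal q) ν) (x : Eu d) :
    truncOp k ν ε (f + g) x = truncOp k ν ε f x + truncOp k ν ε g x := by
  simp_rw [truncOp_eq_integral, Pi.add_apply, mul_add]
  exact integral_add (hk.integrable_truncKernel_mul hn hν hp hε hf x)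
    (hk.integrable_truncKernel_mul hn hν hq hε hg x)

theorem truncOp_indicator {ν : Measure (Eu d)} {ε : ℝ} {B : Set (Eu d)} (hB : MeasurableSet B)
    (f : Eu d → ℂ) (x : Eu d) :
    truncOp k ν ε (B.indicator f) x = ∫ y in B, truncKernel k ε x y * f y ∂ν := by
  rw [truncOp_eq_integral, ← integral_indicator hB]
  congr 1
  ext y
  by_cases hy : y ∈ B <;> simp [hy]

end

/-! ### Cotlar's inequality and weak type `(q,q)` into measures of `n`-growth. -/

/-- Two-sided AD-regularity bounds, the upper one at all points and scales. -/
structure ADBound {d : ℕ} (n a b : ℝ) (μ : Measure (Eu d)) : Prop where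
  a_pos : 0 < a
  b_pos : 0 < b
  lower : ∀ x ∈ μ.support, ∀ r : ℝ, 0 < r → ENNReal.ofReal r ≤ Metric.ediam μ.support →
    ENNReal.ofReal (a⁻¹ * r ^ n) ≤ μ (Metric.closedBall x r)
  upper : ∀ (x : Eu d) (r : ℝ), 0 < r → μ (Metric.closedBall x r) ≤ ENNReal.ofReal (b * r ^ n)

theorem ADBound.hasGrowth {d : ℕ} {n a b : ℝ} {μ : Measure (Eu d)} (h : ADBound n a b μ) :
    HasGrowth n μ := ⟨b, h.b_pos, h.upper⟩

section
variable {d : ℕ} {n c η a b q : ℝ} {k : Eu d → Eu d → ℂ} {μ ν : Measure (Eu d)}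

/-- Contribution to the truncated operator of a ball centred at the evaluation point. -/
theorem CZBound.enorm_near_le (hk : CZBound n c η k) {x : Eu d} {ε s r : ℝ} (hr : 0 < r)
    (hε : 0 < ε) (hn : 0 ≤ n) (hrx : ∀ y ∈ μ.support, ε < ‖x - y‖ → r ≤ ‖x - y‖) (hs : 0 < s)
    {f : Eu d → ℂ} {α : ℝ} (_hα : 0 ≤ α)
    (hf : ∫⁻ y in Metric.closedBall x (s * r), ‖f y‖ₑ ∂μ ≤ ENNReal.ofReal (α * (s * r) ^ n)) :
    ‖∫ y in Metric.closedBall x (s * r), truncKernel k ε x y * f y ∂μ‖ₑ ≤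
      ENNReal.ofReal (c * s ^ n * α) := by
  have hc := hk.c_pos
  refine (enorm_integral_le_lintegral_enorm _).trans ?_
  calc _ ≤ ∫⁻ y in Metric.closedBall x (s * r), ENNReal.ofReal (c / r ^ n) * ‖f y‖ₑ ∂μ := by
        refine lintegral_mono_ae (ae_restrict_of_ae ?_)
        filter_upwards [Measure.support_mem_ae (μ := μ)] with y hy
        rw [enorm_mul]
        refine mul_le_mul_left ?_ _
        rw [← ofReal_norm]
        refine ENNReal.ofReal_le_ofReal ?_
        rcases lt_or_ge ε ‖x - y‖ with h | h
        · have := hrx y hy h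
          exact (hk.norm_truncKernel_le hε x y).trans (by gcongr)
        · rw [truncKernel_of_le h, norm_zero]
          positivity
    _ = ENNReal.ofReal (c / r ^ n) * ∫⁻ y in Metric.closedBall x (s * r), ‖f y‖ₑ ∂μ :=
        lintegral_const_mul' _ _ ENNReal.ofReal_ne_top
    _ ≤ ENNReal.ofReal (c / r ^ n) * ENNReal.ofReal (α * (s * r) ^ n) := by gcongr
    _ = _ := by
        rw [← ENNReal.ofReal_mul (by positivity), Real.mul_rpow hs.le hr.le]
        congr 1
        have := Real.rpow_pos_of_pos hr n
        field_simp

/-- Oscillation of the far part of the truncated operator. -/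
theorem CZBound.enorm_far_sub_le (hk : CZBound n c η k) (hn : 0 < n) {x z : Eu d} {ε r α : ℝ}
    (hε : 0 < ε) (hεr : ε ≤ r) (hz : ‖x - z‖ ≤ 2 * r) {f : Eu d → ℂ} (hα : 0 ≤ α)
    (hfm : AEStronglyMeasurable f μ)
    (hx : Integrable (fun y => truncKernel k ε x y * f y) μ)
    (hzi : Integrable (fun y => truncKernel k ε z y * f y) μ)
    (hf : ∀ s, 0 < s → ∫⁻ y in Metric.closedBall x s, ‖f y‖ₑ ∂μ ≤ ENNReal.ofReal (α * s ^ n)) :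
    ‖(∫ y in (Metric.closedBall x (4 * r))ᶜ, truncKernel k ε x y * f y ∂μ) -
      ∫ y in (Metric.closedBall x (4 * r))ᶜ, truncKernel k ε z y * f y ∂μ‖ₑ ≤
      ENNReal.ofReal (c * (2 ^ n / (1 - (2 ^ η)⁻¹)) * α) := by
  have hc := hk.c_pos
  have hη := hk.eta_pos
  have hr : 0 < r := hε.trans_le hεr
  have h2 : 0 < 1 - (2 ^ η : ℝ)⁻¹ :=
    sub_pos.2 (inv_lt_one_of_one_lt₀ (Real.one_lt_rpow (by norm_num) hη))
  -- The growth hypothesis on `f` around `x` says that the measure `|f| μ` has growth there, so the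
  -- tail estimate applies to it directly.
  set G := μ.withDensity fun y => ‖f y‖ₑ with hG
  have hGb : ∀ s : ℝ, 0 < s → G (Metric.closedBall x s) ≤ ENNReal.ofReal (α * s ^ n) :=
    fun s hs => by
      rw [hG, withDensity_apply _ Metric.isClosed_closedBall.measurableSet]
      exact hf s hs
  have hms : MeasurableSet {y | 4 * r ≤ ‖x - y‖} :=
    measurableSet_le measurable_const (by fun_prop)
  rw [← integral_sub hx.integrableOn hzi.integrableOn]
  refine (enorm_integral_le_lintegral_enorm _).trans ?_
  calc _ ≤ ∫⁻ y in (Metric.closedBall x (4 * r))ᶜ, ENNReal.ofReal (c * (2 * r) ^ η) *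
          (‖f y‖ₑ * ENNReal.ofReal (1 / ‖x - y‖ ^ (n + η))) ∂μ := by
        refine setLIntegral_mono' Metric.isClosed_closedBall.measurableSet.compl fun y hy => ?_
        have hy' : 4 * r < ‖x - y‖ := by
          rw [Set.mem_compl_iff, mem_closedBall_iff_norm', not_le] at hy
          exact hy
        have hzy : ‖x - y‖ ≤ ‖x - z‖ + ‖z - y‖ := norm_sub_le_norm_sub_add_norm_sub x z y
        rw [← sub_mul, truncKernel_of_lt (by linarith), truncKernel_of_lt (by linarith), enorm_mul,
          mul_comm ‖f y‖ₑ, ← mul_assoc]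
        refine mul_le_mul_left ?_ _
        rw [← ofReal_norm, ← ENNReal.ofReal_mul (by positivity)]
        refine ENNReal.ofReal_le_ofReal ?_
        have hne : x ≠ y := sub_ne_zero.1 (norm_pos_iff.1 (by linarith))
        refine (hk.smooth_left x y z hne (by linarith)).trans ?_
        rw [mul_one_div]
        gcongr
    _ ≤ ∫⁻ y in {y | 4 * r ≤ ‖x - y‖}, ENNReal.ofReal (c * (2 * r) ^ η) *
          (‖f y‖ₑ * ENNReal.ofReal (1 / ‖x - y‖ ^ (n + η))) ∂μ := by
        refine lintegral_mono_set fun y hy => ?_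
        rw [Set.mem_compl_iff, mem_closedBall_iff_norm', not_le] at hy
        exact hy.le
    _ = ENNReal.ofReal (c * (2 * r) ^ η) *
          ∫⁻ y in {y | 4 * r ≤ ‖x - y‖}, ENNReal.ofReal (1 / ‖x - y‖ ^ (n + η)) ∂G := by
        rw [lintegral_const_mul' _ _ ENNReal.ofReal_ne_top, hG, restrict_withDensity hms,
          lintegral_withDensity_eq_lintegral_mul₀ hfm.enorm.restrict (by fun_prop)]
        rfl
    _ ≤ ENNReal.ofReal (c * (2 * r) ^ η) *
          ENNReal.ofReal (2 ^ n / (1 - (2 ^ η)⁻¹) * α / (4 * r) ^ η) :=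
        mul_le_mul_right (lintegral_tail_le hn hη hα (by positivity) hGb) _
    _ ≤ _ := by
        rw [← ENNReal.ofReal_mul (by positivity)]
        refine ENNReal.ofReal_le_ofReal ?_
        have h24 : (2 * r) ^ η ≤ (4 * r) ^ η := by gcongr; norm_num
        have h4 : 0 < (4 * r) ^ η := by positivity
        calc _ = c * (2 ^ n / (1 - (2 ^ η)⁻¹)) * α * ((2 * r) ^ η / (4 * r) ^ η) := by
              field_simp
          _ ≤ c * (2 ^ n / (1 - (2 ^ η)⁻¹)) * α * 1 := by
              gcongr
              exact (div_le_one h4).2 h24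
          _ = _ := mul_one _

/-- Cotlar-type inequality: at every point, the truncated operator is controlled by the radial
maximal function of `|f|^q + |T_{μ,ε} f|^q`. -/
theorem CZBound.norm_truncOp_le_of_maximal_le (hk : CZBound n c η k) (hn : 0 < n)
    [IsLocallyFiniteMeasure μ] (hμ : ADBound n a b μ) (hne : μ.support.Nonempty) (hq : 1 < q)
    (hT : IsBoundedStrong k q μ μ) :
    ∃ C : ℝ, 0 < C ∧ ∀ ε : ℝ, 0 < ε → ∀ f : Eu d → ℂ, MemLp f (ENNReal.ofReal q) μ →
      ∀ (x : Eu d) (A : ℝ), 0 < A → (∀ r : ℝ, 0 < r → ∫⁻ y in Metric.closedBall x r,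
        (‖f y‖ₑ ^ q + ‖truncOp k μ ε f y‖ₑ ^ q) ∂μ ≤ ENNReal.ofReal (A * r ^ n)) →
      ‖truncOp k μ ε f x‖ ≤ C * A ^ (1 / q) := by
  obtain ⟨CT, hCT⟩ := hT
  have hc := hk.c_pos
  have hη := hk.eta_pos
  have ha := hμ.a_pos
  have hb := hμ.b_pos
  have hq0 : 0 < q := by linarith
  have h2 : 0 < 1 - (2 ^ η : ℝ)⁻¹ :=
    sub_pos.2 (inv_lt_one_of_one_lt₀ (Real.one_lt_rpow (by norm_num) hη))
  set β := b ^ (1 - 1 / q) with hβdef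
  have hβ : 0 < β := by positivity
  refine ⟨c * 4 ^ n * β + (c * (2 ^ n / (1 - (2 ^ η)⁻¹)) * β + (1 + CT) * β * 4 ^ n * a),
    by positivity, fun ε hε f hf x A hA hmax => ?_⟩
  set α := A ^ (1 / q) with hαdef
  have hα : 0 < α := by positivity
  have hTm : Measurable (truncOp k μ ε f) := hk.measurable_truncOp hε hf.1
  have hint := hk.integrable_truncKernel_mul hn hμ.hasGrowth hq.le hε hf
  have hfq : ∀ s : ℝ, 0 < s → ∫⁻ y in Metric.closedBall x s, ‖f y‖ₑ ^ q ∂μ ≤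
      ENNReal.ofReal (A * s ^ n) := fun s hs =>
    (lintegral_mono fun y => le_self_add).trans (hmax s hs)
  have hTq : ∀ s : ℝ, 0 < s → ∫⁻ y in Metric.closedBall x s, ‖truncOp k μ ε f y‖ₑ ^ q ∂μ ≤
      ENNReal.ofReal (A * s ^ n) := fun s hs =>
    (lintegral_mono fun y => le_add_self).trans (hmax s hs)
  have hf1 : ∀ s : ℝ, 0 < s → ∫⁻ y in Metric.closedBall x s, ‖f y‖ₑ ∂μ ≤
      ENNReal.ofReal (α * β * s ^ n) := fun s hs =>
    setLIntegral_le_of_rpow_le hq hf.1.enorm.restrict hA.le hb.le (by positivity) (hfq s hs)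
      (hμ.upper x s hs)
  obtain ⟨x', hx', hdist⟩ := Measure.isClosed_support.exists_infDist_eq_dist hne x
  -- With this radius every support point beyond the cut-off is at distance at least `r` from `x`,
  -- and `B(x', r)` lies inside `B(x, 2r)`, where the far part oscillates little.
  set r := max ε (dist x x') with hrdef
  have hεr : ε ≤ r := le_max_left _ _
  have hr : 0 < r := hε.trans_le hεr
  have hxx' : dist x x' ≤ r := le_max_right _ _
  have hB : MeasurableSet (Metric.closedBall x (4 * r)) :=
    Metric.isClosed_closedBall.measurableSet
  have hnear := hk.enorm_near_le (μ := μ) (x := x) (f := f) hr hε hn.le (fun y hy hy' => by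
    refine max_le hy'.le ?_
    rw [← hdist, ← dist_eq_norm]
    exact Metric.infDist_le_dist_of_mem hy) (by norm_num : (0 : ℝ) < 4)
    (by positivity : 0 ≤ α * β) (hf1 _ (by positivity))
  have hsplit : truncOp k μ ε f x = (∫ y in Metric.closedBall x (4 * r), truncKernel k ε x y * f y ∂μ)
      + ∫ y in (Metric.closedBall x (4 * r))ᶜ, truncKernel k ε x y * f y ∂μ := by
    rw [truncOp_eq_integral, integral_add_compl hB (hint x)]
  have hfar : ‖∫ y in (Metric.closedBall x (4 * r))ᶜ, truncKernel k ε x y * f y ∂μ‖ₑ ≤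
      ENNReal.ofReal (c * (2 ^ n / (1 - (2 ^ η)⁻¹)) * (α * β)) +
        ENNReal.ofReal ((1 + CT) * (α * β) * 4 ^ n * a) := by
    -- If `r` exceeds the diameter, `B(x, 4r)` contains the whole support and there is no far part.
    -- Otherwise the lower regularity bound is available at `x'` at scale `r`.
    by_cases hd : ENNReal.ofReal r ≤ Metric.ediam μ.support
    swap
    · push Not at hd
      have : μ (Metric.closedBall x (4 * r))ᶜ = 0 := by
        refine measure_mono_null (t := μ.supportᶜ) (fun y hy hyK => hy ?_)
          Measure.measure_compl_support
        have h1 : edist x' y < ENNReal.ofReal r := (Metric.edist_le_ediam_of_mem hx' hyK).trans_lt hd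
        rw [edist_lt_ofReal] at h1
        rw [Metric.mem_closedBall, dist_comm]
        linarith [dist_triangle x x' y]
      rw [Measure.restrict_eq_zero.2 this, integral_zero_measure, enorm_zero]
      exact zero_le
    set B' := Metric.closedBall x' r with hB'
    have hB'm : MeasurableSet B' := Metric.isClosed_closedBall.measurableSet
    have hsub : B' ⊆ Metric.closedBall x (4 * r) := by
      refine Metric.closedBall_subset_closedBall' ?_
      rw [dist_comm]
      linarith
    have hB'b : μ B' ≤ ENNReal.ofReal (b * (4 * r) ^ n) :=
      (measure_mono hsub).trans (hμ.upper x _ (by positivity))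
    have hlow := hμ.lower x' hx' r hr hd
    have hB'0 : μ B' ≠ 0 := fun h0 => by
      rw [← hB', h0, nonpos_iff_eq_zero, ENNReal.ofReal_eq_zero] at hlow
      exact absurd hlow (not_le.2 (by positivity))
    have hB'top : μ B' ≠ ∞ := (hB'b.trans_lt ENNReal.ofReal_lt_top).ne
    set fB := (Metric.closedBall x (4 * r)).indicator f with hfB
    have hfBL : MemLp fB (ENNReal.ofReal q) μ := hf.indicator hB
    have hTBm : Measurable (truncOp k μ ε fB) := hk.measurable_truncOp hε hfBL.1
    have i1 : ∫⁻ z in B', ‖truncOp k μ ε f z‖ₑ ∂μ ≤ ENNReal.ofReal (α * β * (4 * r) ^ n) :=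
      setLIntegral_le_of_rpow_le hq hTm.enorm.aemeasurable hA.le hb.le (by positivity)
        ((lintegral_mono_set hsub).trans (hTq _ (by positivity))) hB'b
    have i2 : ∫⁻ z in B', ‖truncOp k μ ε fB z‖ₑ ∂μ ≤
        ENNReal.ofReal (CT * α * β * (4 * r) ^ n) := by
      -- The operator constant is moved inside the `q`-th root so that the Hölder estimate can be
      -- used with `CT ^ q * A` in place of `A`.
      have : (CT : ℝ) * α = ((CT : ℝ) ^ q * A) ^ (1 / q) := by
        rw [Real.mul_rpow (by positivity) hA.le, ← Real.rpow_mul (by positivity),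
          mul_one_div_cancel hq0.ne', Real.rpow_one]
      rw [this]
      refine setLIntegral_le_of_rpow_le hq hTBm.enorm.aemeasurable (by positivity) hb.le
        (by positivity) ?_ hB'b
      calc ∫⁻ z in B', ‖truncOp k μ ε fB z‖ₑ ^ q ∂μ ≤ ∫⁻ z, ‖truncOp k μ ε fB z‖ₑ ^ q ∂μ :=
            setLIntegral_le_lintegral _ _
        _ = eLpNorm (truncOp k μ ε fB) (ENNReal.ofReal q) μ ^ q := (eLpNorm_ofReal_rpow hq0 _).symm
        _ ≤ (CT * eLpNorm fB (ENNReal.ofReal q) μ) ^ q :=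
            ENNReal.rpow_le_rpow (hCT ε hε fB hfBL) hq0.le
        _ = (CT : ℝ≥0∞) ^ q * ∫⁻ z in Metric.closedBall x (4 * r), ‖f z‖ₑ ^ q ∂μ := by
            rw [ENNReal.mul_rpow_of_nonneg _ _ hq0.le, hfB, eLpNorm_indicator_eq_eLpNorm_restrict hB,
              eLpNorm_ofReal_rpow hq0]
        _ ≤ (CT : ℝ≥0∞) ^ q * ENNReal.ofReal (A * (4 * r) ^ n) :=
            mul_le_mul_right (hfq _ (by positivity)) _
        _ = _ := by
            rw [← ENNReal.ofReal_coe_nnreal, ENNReal.ofReal_rpow_of_nonneg (by positivity) hq0.le,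
              ← ENNReal.ofReal_mul (by positivity), mul_assoc]
    -- At `z` the far integral is `T f - T fB`, and the left side does not depend on `z`.
    -- Integrating over `B'` and dividing by its positive finite mass therefore gives a bound at the
    -- fixed point `x`.
    have hpt : ∀ z ∈ B', ‖∫ y in (Metric.closedBall x (4 * r))ᶜ, truncKernel k ε x y * f y ∂μ‖ₑ ≤
        ENNReal.ofReal (c * (2 ^ n / (1 - (2 ^ η)⁻¹)) * (α * β)) +
          (‖truncOp k μ ε f z‖ₑ + ‖truncOp k μ ε fB z‖ₑ) := fun z hz => by
      have hxz : ‖x - z‖ ≤ 2 * r := by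
        rw [← dist_eq_norm]
        rw [hB', Metric.mem_closedBall, dist_comm] at hz
        linarith [dist_triangle x x' z]
      have h1 := hk.enorm_far_sub_le hn hε hεr hxz (by positivity : 0 ≤ α * β) hf.1 (hint x)
        (hint z) hf1
      have h3 : ∫ y in (Metric.closedBall x (4 * r))ᶜ, truncKernel k ε z y * f y ∂μ =
          truncOp k μ ε f z - truncOp k μ ε fB z := by
        rw [hfB, truncOp_indicator hB, truncOp_eq_integral, ← integral_add_compl hB (hint z)]
        ring
      rw [h3] at h1
      calc _ = ‖((∫ y in (Metric.closedBall x (4 * r))ᶜ, truncKernel k ε x y * f y ∂μ) -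
            (truncOp k μ ε f z - truncOp k μ ε fB z)) +
            (truncOp k μ ε f z - truncOp k μ ε fB z)‖ₑ := by rw [sub_add_cancel]
        _ ≤ _ := (enorm_add_le _ _).trans (add_le_add h1 enorm_sub_le)
    have havg : ‖∫ y in (Metric.closedBall x (4 * r))ᶜ, truncKernel k ε x y * f y ∂μ‖ₑ * μ B' ≤
        (ENNReal.ofReal (c * (2 ^ n / (1 - (2 ^ η)⁻¹)) * (α * β)) +
          ENNReal.ofReal ((1 + CT) * (α * β) * 4 ^ n * a)) * μ B' := by
      rw [← setLIntegral_const]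
      refine (setLIntegral_mono' hB'm hpt).trans ?_
      rw [lintegral_add_left measurable_const, setLIntegral_const,
        lintegral_add_left hTm.enorm, add_mul]
      refine add_le_add le_rfl ((add_le_add i1 i2).trans ?_)
      refine le_trans (le_of_eq ?_) (mul_le_mul_right hlow _)
      rw [← ENNReal.ofReal_add (by positivity) (by positivity),
        ← ENNReal.ofReal_mul (by positivity), Real.mul_rpow (by norm_num) hr.le]
      congr 1
      field_simp
    exact (ENNReal.mul_le_mul_iff_left hB'0 hB'top).1 havg
  rw [← ENNReal.ofReal_le_ofReal_iff (by positivity), ofReal_norm, hsplit]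
  refine (enorm_add_le _ _).trans ((add_le_add hnear hfar).trans_eq ?_)
  rw [← ENNReal.ofReal_add (by positivity) (by positivity),
    ← ENNReal.ofReal_add (by positivity) (by positivity)]
  congr 1
  ring

/-- An operator bounded on `L^q(μ)` is of weak type `(q,q)` into any measure of `n`-growth. -/
theorem CZBound.isBoundedWeak_of_isBoundedStrong (hk : CZBound n c η k) (hn : 0 < n)
    [IsLocallyFiniteMeasure μ] (hμ : ADBound n a b μ) (hne : μ.support.Nonempty) (hq : 1 < q)
    (hT : IsBoundedStrong k q μ μ) (hν : HasGrowth n ν) : IsBoundedWeak k q μ ν := by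
  obtain ⟨C, hC, hpt⟩ := hk.norm_truncOp_le_of_maximal_le hn hμ hne hq hT
  obtain ⟨CT, hCT⟩ := hT
  obtain ⟨cν, hcν, hν⟩ := hν
  have hq0 : 0 < q := by linarith
  refine ⟨(cν * 5 ^ n * C ^ q).toNNReal * (1 + CT ^ q), fun ε hε f hf t ht => ?_⟩
  have hTm : Measurable (truncOp k μ ε f) := hk.measurable_truncOp hε hf.1
  -- Chosen so that `C * A ^ (1 / q) = t`: wherever the operator exceeds `t`, the maximal function
  -- must exceed `A`.
  set A := (t / C) ^ q with hA
  have hA0 : 0 < A := by positivity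
  have hCA : C * A ^ (1 / q) = t := by
    rw [hA, ← Real.rpow_mul (by positivity), mul_one_div_cancel hq0.ne', Real.rpow_one]
    field_simp
  set G := μ.withDensity fun y => ‖f y‖ₑ ^ q + ‖truncOp k μ ε f y‖ₑ ^ q with hG
  have hGu : G Set.univ ≤ (1 + CT ^ q : ℝ≥0) * eLpNorm f (ENNReal.ofReal q) μ ^ q := by
    rw [hG, withDensity_apply _ MeasurableSet.univ, Measure.restrict_univ,
      lintegral_add_right _ (hTm.enorm.pow_const q), ← eLpNorm_ofReal_rpow hq0,
      ← eLpNorm_ofReal_rpow hq0, ENNReal.coe_add, add_mul, ENNReal.coe_one, one_mul,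
      ENNReal.coe_rpow_of_nonneg _ hq0.le, ← ENNReal.mul_rpow_of_nonneg _ _ hq0.le]
    exact add_le_add le_rfl (ENNReal.rpow_le_rpow (hCT ε hε f hf) hq0.le)
  calc ν {x | t < ‖truncOp k μ ε f x‖}
      ≤ ν {x | ∃ r : ℝ, 0 < r ∧ ENNReal.ofReal (A * r ^ n) < G (Metric.closedBall x r)} := by
        refine measure_mono fun x hx => ?_
        by_contra hcon
        have hall : ∀ r : ℝ, 0 < r → ∫⁻ y in Metric.closedBall x r,
            (‖f y‖ₑ ^ q + ‖truncOp k μ ε f y‖ₑ ^ q) ∂μ ≤ ENNReal.ofReal (A * r ^ n) :=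
          fun r hr => by
            rw [← withDensity_apply _ Metric.isClosed_closedBall.measurableSet]
            exact not_lt.1 fun h => hcon ⟨r, hr, h⟩
        have := hpt ε hε f hf x A hA0 hall
        rw [hCA] at this
        exact absurd hx (not_lt.2 this)
    _ ≤ ENNReal.ofReal (cν * 5 ^ n / A) * G Set.univ := measure_maximal_gt_le hn hcν hν G hA0
    _ ≤ ENNReal.ofReal (cν * 5 ^ n / A) *
          ((1 + CT ^ q : ℝ≥0) * eLpNorm f (ENNReal.ofReal q) μ ^ q) := mul_le_mul_right hGu _
    _ = _ := by
        rw [← mul_assoc, ENNReal.coe_mul, ← ENNReal.ofReal, ENNReal.mul_div_right_comm,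
          ← ENNReal.ofReal_div_of_pos (by positivity)]
        congr 3
        rw [hA, Real.div_rpow ht.le hC.le]
        field_simp

end

/-! ### Calderón-Zygmund decomposition of measures. -/

/-- Each point is assigned to the set of least index containing it. This divides the mass on the
overlapping enlarged balls into pieces without counting any of it twice. -/
theorem exists_measurable_disjoint_refinement {α ι : Type*} [MeasurableSpace α] [Countable ι]
    {S : ι → Set α} (hS : ∀ i, MeasurableSet (S i)) :
    ∃ Q : ι → Set α, (∀ i, MeasurableSet (Q i)) ∧ (∀ i, Q i ⊆ S i) ∧
      Pairwise (Function.onFun Disjoint Q) ∧ ⋃ i, Q i = ⋃ i, S i := by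
  obtain ⟨e, he⟩ := exists_injective_nat ι
  refine ⟨fun i => S i \ ⋃ (j : ι) (_ : e j < e i), S j, fun i => (hS i).diff
    (MeasurableSet.iUnion fun j => MeasurableSet.iUnion fun _ => hS j), fun i => Set.sdiff_subset,
    fun i j hij => ?_, ?_⟩
  · rw [Function.onFun, Set.disjoint_left]
    rintro y ⟨hyi, hyi'⟩ ⟨hyj, hyj'⟩
    rcases lt_trichotomy (e i) (e j) with h | h | h
    · exact hyj' (Set.mem_iUnion₂.2 ⟨i, h, hyi⟩)
    · exact hij (he h)
    · exact hyi' (Set.mem_iUnion₂.2 ⟨j, h, hyj⟩)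
  · refine subset_antisymm (Set.iUnion_mono fun i => Set.sdiff_subset) fun y hy => ?_
    classical
    have hex : ∃ m, ∃ i, e i = m ∧ y ∈ S i := by
      obtain ⟨i, hi⟩ := Set.mem_iUnion.1 hy
      exact ⟨e i, i, rfl, hi⟩
    obtain ⟨i, hi, hyi⟩ := Nat.find_spec hex
    refine Set.mem_iUnion.2 ⟨i, hyi, fun hcon => ?_⟩
    obtain ⟨j, hj, hyj⟩ := Set.mem_iUnion₂.1 hcon
    rw [hi] at hj
    exact Nat.find_min hex hj ⟨j, rfl, hyj⟩

section
variable {d : ℕ} {n a b t : ℝ} {μ τ : Measure (Eu d)}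

/-- The radii of high density are bounded because `τ` is finite. One larger than a fifth of their
supremum works: its fivefold dilate is beyond the supremum, hence not of high density. -/
theorem exists_almost_maximal_radius {τ : Measure (Eu d)} [IsFiniteMeasure τ] (hn : 0 < n)
    (ht : 0 < t) {x : Eu d}
    (hx : ∃ r : ℝ, 0 < r ∧ ENNReal.ofReal (t * r ^ n) < τ (Metric.closedBall x r)) :
    ∃ r : ℝ, 0 < r ∧ ENNReal.ofReal (t * r ^ n) < τ (Metric.closedBall x r) ∧
      τ (Metric.closedBall x (5 * r)) ≤ ENNReal.ofReal (t * (5 * r) ^ n) := by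
  set T := {r : ℝ | 0 < r ∧ ENNReal.ofReal (t * r ^ n) < τ (Metric.closedBall x r)} with hT
  have hne : T.Nonempty := hx
  have hbdd : BddAbove T := by
    refine ⟨((τ Set.univ).toReal / t) ^ n⁻¹, fun r hr => ?_⟩
    have hr0 : 0 < r := hr.1
    rw [Real.le_rpow_inv_iff_of_pos hr0.le (by positivity) hn, le_div_iff₀ ht, mul_comm]
    exact ((ENNReal.ofReal_lt_iff_lt_toReal (by positivity) (measure_ne_top _ _)).1
      (hr.2.trans_le (measure_mono (Set.subset_univ _)))).le
  have hs : 0 < sSup T := by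
    obtain ⟨r, hr⟩ := hne
    exact hr.1.trans_le (le_csSup hbdd hr)
  obtain ⟨r, hr, hr'⟩ := exists_lt_of_lt_csSup hne (show sSup T / 5 < sSup T by linarith)
  have hr0 : 0 < r := hr.1
  refine ⟨r, hr.1, hr.2, not_lt.1 fun hcon => ?_⟩
  have : 5 * r ∈ T := ⟨by positivity, hcon⟩
  linarith [le_csSup hbdd this]

/-- Calderón-Zygmund decomposition of a finite positive measure carried by the support of an
AD-regular measure. -/
theorem ADBound.exists_calderonZygmund_decomposition (hn : 0 < n) [IsLocallyFiniteMeasure μ]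
    (hμ : ADBound n a b μ) (ht : 0 < t) [IsFiniteMeasure τ] (hτ : τ μ.supportᶜ = 0)
    (hH : ∀ r : ℝ, 0 < r → ENNReal.ofReal (t * r ^ n) < τ Set.univ →
      ENNReal.ofReal r ≤ Metric.ediam μ.support) :
    ∃ (u : Set (Eu d)) (r : u → ℝ) (τ₀ g : Measure (Eu d)) (τ' γ : u → Measure (Eu d)),
      u.Countable ∧ (∀ i, 0 < r i) ∧
      ∑' i, ENNReal.ofReal (t * r i ^ n) ≤ τ Set.univ ∧
      (∀ i, τ' i Set.univ = γ i Set.univ) ∧ ∑' i, τ' i Set.univ ≤ τ Set.univ ∧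
      (∀ i : u, ∀ᵐ y ∂τ' i, ‖(i : Eu d) - y‖ ≤ 5 * r i) ∧
      (∀ i : u, ∀ᵐ y ∂γ i, ‖(i : Eu d) - y‖ ≤ 5 * r i) ∧
      τ = τ₀ + Measure.sum τ' ∧ g = τ₀ + Measure.sum γ ∧ g Set.univ = τ Set.univ ∧
      g ≤ ENNReal.ofReal (2 * a * 5 ^ n * t) • μ := by
  have ha := hμ.a_pos
  have hb := hμ.b_pos
  set K := μ.support with hK
  have hKm : MeasurableSet K := Measure.isClosed_support.measurableSet
  -- Only support points are selected, since the lower mass bound on the selected balls holds only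
  -- for centres in the support.
  set S := {x : Eu d | x ∈ K ∧
    ∃ r : ℝ, 0 < r ∧ ENNReal.ofReal (t * r ^ n) < τ (Metric.closedBall x r)} with hS
  have hrad : ∀ x : Eu d, ∃ r : ℝ, x ∈ S →
      0 < r ∧ ENNReal.ofReal (t * r ^ n) < τ (Metric.closedBall x r) ∧
      τ (Metric.closedBall x (5 * r)) ≤ ENNReal.ofReal (t * (5 * r) ^ n) := fun x => by
    by_cases hx : x ∈ S
    · obtain ⟨r, hr⟩ := exists_almost_maximal_radius hn ht hx.2
      exact ⟨r, fun _ => hr⟩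
    · exact ⟨0, fun h => absurd h hx⟩
  choose r hr using hrad
  have hlt : ∀ x ∈ S, ENNReal.ofReal (t * r x ^ n) < τ Set.univ := fun x hx =>
    (hr x hx).2.1.trans_le (measure_mono (Set.subset_univ _))
  obtain ⟨u, huS, hu, hdisj, hcov⟩ := exists_countable_vitali_cover S r
    (((τ Set.univ).toReal / t) ^ n⁻¹) (fun x hx => by
      have h0 := (hr x hx).1
      refine ⟨h0, ?_⟩
      rw [Real.le_rpow_inv_iff_of_pos h0.le (by positivity) hn, le_div_iff₀ ht, mul_comm]
      exact ((ENNReal.ofReal_lt_iff_lt_toReal (by positivity) (measure_ne_top _ _)).1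
        (hlt x hx)).le)
  have := hu.to_subtype
  obtain ⟨Q, hQm, hQsub, hQdisj, hQU⟩ := exists_measurable_disjoint_refinement
    (S := fun i : u => Metric.closedBall (i : Eu d) (5 * r i))
    (fun i => Metric.isClosed_closedBall.measurableSet)
  set U := ⋃ i, Q i with hU
  have hUm : MeasurableSet U := MeasurableSet.iUnion hQm
  set B : u → Set (Eu d) := fun i => Metric.closedBall (i : Eu d) (r i) with hBdef
  have hBm : ∀ i, MeasurableSet (B i) := fun i => Metric.isClosed_closedBall.measurableSet
  have hBdisj : Pairwise (Function.onFun Disjoint B) := fun i j hij =>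
    hdisj i.2 j.2 fun h => hij (Subtype.ext h)
  have hr0 : ∀ i : u, 0 < r i := fun i => (hr i (huS i.2)).1
  have hBlow : ∀ i : u, ENNReal.ofReal (a⁻¹ * r i ^ n) ≤ μ (B i) := fun i =>
    hμ.lower i (huS i.2).1 _ (hr0 i) (hH _ (hr0 i) (hlt i (huS i.2)))
  have hB0 : ∀ i, μ (B i) ≠ 0 := fun i h0 => by
    have := hBlow i
    rw [h0, nonpos_iff_eq_zero, ENNReal.ofReal_eq_zero] at this
    have h1 := hr0 i
    exact absurd this (not_le.2 (by positivity))
  have hBtop : ∀ i, μ (B i) ≠ ∞ := fun i =>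
    ((hμ.upper _ _ (hr0 i)).trans_lt ENNReal.ofReal_lt_top).ne
  -- The mass of `Q i`, which lives in the fivefold ball, is spread over the original ball `B i`.
  -- These balls are disjoint, so the densities of the `γ i` do not add up.
  set γ : u → Measure (Eu d) := fun i => (τ (Q i) / μ (B i)) • μ.restrict (B i) with hγ
  have hγu : ∀ i, γ i Set.univ = τ (Q i) := fun i => by
    rw [hγ]
    simp only [Measure.smul_apply, Measure.restrict_apply_univ, smul_eq_mul]
    exact ENNReal.div_mul_cancel (hB0 i) (hBtop i)
  have hratio : ∀ i, τ (Q i) / μ (B i) ≤ ENNReal.ofReal (a * 5 ^ n * t) := fun i => by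
    have h1 := hr0 i
    refine ENNReal.div_le_of_le_mul ?_
    calc τ (Q i) ≤ τ (Metric.closedBall (i : Eu d) (5 * r i)) := measure_mono (hQsub i)
      _ ≤ ENNReal.ofReal (t * (5 * r i) ^ n) := (hr i (huS i.2)).2.2
      _ = ENNReal.ofReal (a * 5 ^ n * t) * ENNReal.ofReal (a⁻¹ * r i ^ n) := by
          rw [← ENNReal.ofReal_mul (by positivity), Real.mul_rpow (by norm_num) h1.le]
          congr 1
          field_simp
      _ ≤ _ := mul_le_mul_right (hBlow i) _
  have hsplit : τ = τ.restrict Uᶜ + Measure.sum fun i => τ.restrict (Q i) := by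
    rw [← Measure.restrict_iUnion hQdisj hQm, ← hU, add_comm, Measure.restrict_add_restrict_compl hUm]
  have hγsum : (Measure.sum γ) Set.univ = (Measure.sum fun i => τ.restrict (Q i)) Set.univ := by
    rw [Measure.sum_apply _ MeasurableSet.univ, Measure.sum_apply _ MeasurableSet.univ]
    exact tsum_congr fun i => by rw [hγu, Measure.restrict_apply_univ]
  refine ⟨u, fun i => r i, τ.restrict Uᶜ, _, fun i => τ.restrict (Q i), γ, hu, hr0, ?_,
    fun i => by rw [hγu, Measure.restrict_apply_univ], ?_, fun i => ?_, fun i => ?_, hsplit, rfl,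
    ?_, ?_⟩
  · refine (ENNReal.tsum_le_tsum fun i : u => (hr i (huS i.2)).2.1.le).trans ?_
    exact tsum_measure_closedBall_le hu hdisj τ fun _ _ => Set.subset_univ _
  · simp_rw [Measure.restrict_apply_univ]
    rw [← measure_iUnion hQdisj hQm]
    exact measure_mono (Set.subset_univ _)
  · filter_upwards [ae_restrict_mem (hQm i)] with y hy
    exact mem_closedBall_iff_norm'.1 (hQsub i hy)
  · refine Measure.ae_smul_measure ?_ _
    filter_upwards [ae_restrict_mem (hBm i)] with y hy
    have h1 := mem_closedBall_iff_norm'.1 hy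
    have := hr0 i
    linarith
  · conv_rhs => rw [hsplit]
    rw [Measure.add_apply, Measure.add_apply, hγsum]
  · have hconst : ENNReal.ofReal (2 * a * 5 ^ n * t) =
        ENNReal.ofReal (a * t * 5 ^ n) + ENNReal.ofReal (a * 5 ^ n * t) := by
      rw [← ENNReal.ofReal_add (by positivity) (by positivity)]
      congr 1
      ring
    refine Measure.le_iff.2 fun A hA => ?_
    rw [Measure.add_apply, Measure.smul_apply, smul_eq_mul, hconst, add_mul]
    refine add_le_add ?_ ?_
    · rw [Measure.restrict_apply hA]
      by_cases h0 : τ Set.univ = 0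
      · rw [measure_mono_null (Set.subset_univ _) h0]
        exact zero_le
      -- Every radius up to this `r₀` also satisfies the premise of `hH`, so the lower regularity
      -- bound holds at all these scales, as the density comparison requires.
      obtain ⟨r₀, hr₀, hr₀'⟩ : ∃ r₀ : ℝ, 0 < r₀ ∧ ENNReal.ofReal (t * r₀ ^ n) < τ Set.univ := by
        have hm : 0 < (τ Set.univ).toReal := ENNReal.toReal_pos h0 (measure_ne_top _ _)
        refine ⟨((τ Set.univ).toReal / (2 * t)) ^ n⁻¹, by positivity, ?_⟩
        rw [ENNReal.ofReal_lt_iff_lt_toReal (by positivity) (measure_ne_top _ _),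
          ← Real.rpow_mul (by positivity), inv_mul_cancel₀ hn.ne', Real.rpow_one]
        calc t * ((τ Set.univ).toReal / (2 * t)) = (τ Set.univ).toReal / 2 := by field_simp
          _ < _ := by linarith
      have hsubU : ∀ x ∈ A ∩ Uᶜ ∩ K, ∀ s : ℝ, 0 < s →
          τ (Metric.closedBall x s) ≤ ENNReal.ofReal (t * s ^ n) := fun x hx s hs => by
        by_contra hcon
        refine hx.1.2 ?_
        rw [hQU]
        have hxS : x ∈ S := ⟨hx.2, s, hs, not_le.1 hcon⟩
        obtain ⟨i, hi, hxi⟩ := Set.mem_iUnion₂.1 (hcov hxS)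
        exact Set.mem_iUnion.2 ⟨⟨i, hi⟩, hxi⟩
      calc τ (A ∩ Uᶜ) ≤ τ (A ∩ Uᶜ ∩ K ∪ Kᶜ) := measure_mono fun y hy => by
            by_cases hyK : y ∈ K
            · exact Or.inl ⟨hy, hyK⟩
            · exact Or.inr hyK
        _ ≤ τ (A ∩ Uᶜ ∩ K) + τ Kᶜ := measure_union_le _ _
        _ = τ (A ∩ Uᶜ ∩ K) := by rw [hτ, add_zero]
        _ ≤ ENNReal.ofReal (a * t * 5 ^ n) * μ (A ∩ Uᶜ ∩ K) :=
            measure_le_of_density_le ha ht hr₀ (fun x hx s hs hs' =>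
              hμ.lower x hx.2 s hs (hH s hs (lt_of_le_of_lt (by gcongr) hr₀'))) hsubU
        _ ≤ _ := mul_le_mul_right
            (measure_mono (Set.inter_subset_left.trans Set.inter_subset_left)) _
    · rw [Measure.sum_apply _ hA]
      calc ∑' i, γ i A ≤ ∑' i, ENNReal.ofReal (a * 5 ^ n * t) * μ (A ∩ B i) := by
            refine ENNReal.tsum_le_tsum fun i => ?_
            rw [hγ]
            simp only [Measure.smul_apply, Measure.restrict_apply hA, smul_eq_mul]
            exact mul_le_mul_left (hratio i) _
        _ = ENNReal.ofReal (a * 5 ^ n * t) * μ (⋃ i, A ∩ B i) := by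
            rw [ENNReal.tsum_mul_left, measure_iUnion (fun i j hij =>
              (hBdisj hij).mono Set.inter_subset_right Set.inter_subset_right)
              fun i => hA.inter (hBm i)]
        _ ≤ _ := mul_le_mul_right
            (measure_mono (Set.iUnion_subset fun i => Set.inter_subset_left)) _

/-- Domination gives absolute continuity, and comparing the integrals of the Radon-Nikodym
derivative over sets bounds it almost everywhere. This makes the good measure a bounded function. -/
theorem exists_withDensity_of_le_smul {α : Type*} [MeasurableSpace α] {μ g : Measure α}
    [SigmaFinite μ] [SigmaFinite g] {M : ℝ≥0∞} (h : g ≤ M • μ) :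
    ∃ ρ : α → ℝ≥0∞, Measurable ρ ∧ (∀ᵐ x ∂μ, ρ x ≤ M) ∧ g = μ.withDensity ρ := by
  have hac : g ≪ μ := Measure.absolutelyContinuous_of_le_smul h
  refine ⟨g.rnDeriv μ, Measure.measurable_rnDeriv _ _, ?_,
    (Measure.withDensity_rnDeriv_eq g μ hac).symm⟩
  refine ae_le_of_forall_setLIntegral_le_of_sigmaFinite (Measure.measurable_rnDeriv _ _)
    fun s hs _ => ?_
  rw [setLIntegral_const]
  exact (Measure.setLIntegral_rnDeriv_le s).trans (h s)

end

/-! ### Weak type `(1,1)` for positive measures. -/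

section
variable {d : ℕ} {n c η a b t ε : ℝ} {k : Eu d → Eu d → ℂ} {μ ν τ : Measure (Eu d)}

theorem CZBound.measurable_potential (hk : CZBound n c η k) (hε : 0 < ε) (τ : Measure (Eu d))
    [SFinite τ] : Measurable fun x => ∫ y, truncKernel k ε x y ∂τ :=
  ((hk.measurable_truncKernel hε).stronglyMeasurable.integral_prod_right (ν := τ)).measurable

/-- The weak `(1,1)` bound when the level is small compared with the average of `τ`. -/
theorem CZBound.measure_potential_gt_le_of_large (hk : CZBound n c η k) (hn : 0 < n) {cν : ℝ}
    (hcν : 0 < cν)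
    (hν : ∀ (x : Eu d) (r : ℝ), 0 < r → ν (Metric.closedBall x r) ≤ ENNReal.ofReal (cν * r ^ n))
    (hε : 0 < ε) [IsFiniteMeasure τ] {K : Set (Eu d)} (hτ : τ Kᶜ = 0) (hne : K.Nonempty)
    (ht : 0 < t) {r : ℝ} (hr : 0 < r) (hrt : ENNReal.ofReal (t * r ^ n) < τ Set.univ)
    (hd : Metric.ediam K < ENNReal.ofReal r) :
    ν {x | t < ‖∫ y, truncKernel k ε x y ∂τ‖} ≤
      ENNReal.ofReal (cν * (2 ^ n * (1 + c))) * τ Set.univ / ENNReal.ofReal t := by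
  have hc := hk.c_pos
  obtain ⟨x₀, hx₀⟩ := hne
  set m := τ.real Set.univ with hm
  have hmτ : ENNReal.ofReal m = τ Set.univ := ofReal_measureReal
  have hrm : t * r ^ n < m :=
    (ENNReal.ofReal_lt_iff_lt_toReal (by positivity) (measure_ne_top _ _)).1 hrt
  have hm0 : 0 < m := lt_trans (by positivity) hrm
  -- The factor `2 ^ n` makes `R ≥ 2r`, so that outside `B(x₀, R)` the distance to `K` is at least
  -- `R / 2`; the factor `1 + c` then brings the potential below `t`.
  set R := (2 ^ n * (1 + c) * m / t) ^ n⁻¹ with hR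
  have hR0 : 0 < R := by positivity
  have hRn : R ^ n = 2 ^ n * (1 + c) * m / t := by
    rw [hR, ← Real.rpow_mul (by positivity), inv_mul_cancel₀ hn.ne', Real.rpow_one]
  have hRr : 2 * r ≤ R := by
    rw [← Real.rpow_le_rpow_iff (by positivity) hR0.le hn, hRn, Real.mul_rpow (by norm_num) hr.le,
      le_div_iff₀ ht]
    calc 2 ^ n * r ^ n * t = 2 ^ n * (1 * (t * r ^ n)) := by ring
      _ ≤ 2 ^ n * ((1 + c) * m) := by
          gcongr
          linarith
      _ = _ := by ring
  calc ν {x | t < ‖∫ y, truncKernel k ε x y ∂τ‖} ≤ ν (Metric.closedBall x₀ R) := by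
        refine measure_mono fun x hx => ?_
        by_contra hcon
        rw [Metric.mem_closedBall, not_le] at hcon
        have hx' : t < ‖∫ y, truncKernel k ε x y ∂τ‖ := hx
        refine absurd hx' (not_lt.2 ?_)
        have hb : ∀ᵐ y ∂τ, ‖truncKernel k ε x y‖ ≤ c / (R / 2) ^ n := by
          have hKae : ∀ᵐ y ∂τ, y ∈ K := hτ
          filter_upwards [hKae] with y hy
          have h1 : edist y x₀ < ENNReal.ofReal r :=
            (Metric.edist_le_ediam_of_mem hy hx₀).trans_lt hd
          rw [edist_lt_ofReal] at h1
          have h2 : R / 2 ≤ ‖x - y‖ := by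
            rw [← dist_eq_norm]
            linarith [dist_triangle x y x₀]
          exact (hk.norm_truncKernel_le hε x y).trans (by gcongr)
        refine (norm_integral_le_of_norm_le_const hb).trans ?_
        rw [← hm, Real.div_rpow hR0.le (by norm_num), hRn]
        have h2n : (0 : ℝ) < 2 ^ n := by positivity
        calc c / (2 ^ n * (1 + c) * m / t / 2 ^ n) * m = t * (c / (1 + c)) := by
              field_simp
          _ ≤ t * 1 := by
              gcongr
              rw [div_le_one (by positivity)]
              linarith
          _ = t := mul_one t
    _ ≤ ENNReal.ofReal (cν * R ^ n) := hν _ _ hR0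
    _ = _ := by
        rw [hRn, ← hmτ, ← ENNReal.ofReal_mul (by positivity), ← ENNReal.ofReal_div_of_pos ht]
        congr 1
        ring

/-- The unmodified part `τ₀` is common to both measures and cancels, leaving the sum of the local
differences, each of which has cancellation. -/
theorem hasSum_integral_sub_of_sum_measure {α ι : Type*} [MeasurableSpace α]
    {τ₀ : Measure α} {τ' γ : ι → Measure α} {f : α → ℂ}
    (hτ : Integrable f (τ₀ + Measure.sum τ')) (hγ : Integrable f (τ₀ + Measure.sum γ)) :
    HasSum (fun i => (∫ y, f y ∂τ' i) - ∫ y, f y ∂γ i)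
      ((∫ y, f y ∂(τ₀ + Measure.sum τ')) - ∫ y, f y ∂(τ₀ + Measure.sum γ)) := by
  rw [integrable_add_measure] at hτ hγ
  rw [integral_add_measure hτ.1 hτ.2, integral_add_measure hγ.1 hγ.2, add_sub_add_left_eq_sub]
  exact (hasSum_integral_measure hτ.2).sub (hasSum_integral_measure hγ.2)

/-- Bound for the good part of the Calderón-Zygmund decomposition. -/
theorem measure_potential_gt_le_of_le_smul
    [SigmaFinite μ] {C : ℝ≥0}
    (hC : ∀ f : Eu d → ℂ, MemLp f (ENNReal.ofReal 2) μ → ∀ t : ℝ, 0 < t →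
      ν {x | t < ‖truncOp k μ ε f x‖} ≤
        C / ENNReal.ofReal (t ^ (2 : ℝ)) * eLpNorm f (ENNReal.ofReal 2) μ ^ (2 : ℝ))
    {g : Measure (Eu d)} [IsFiniteMeasure g] {M : ℝ} (hM : 0 ≤ M) (ht : 0 < t)
    (hg : g ≤ ENNReal.ofReal (M * t) • μ) :
    ν {x | t < ‖∫ y, truncKernel k ε x y ∂g‖} ≤
      C * ENNReal.ofReal M * g Set.univ / ENNReal.ofReal t := by
  obtain ⟨ρ, hρm, hρ, hgρ⟩ := exists_withDensity_of_le_smul hg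
  have hfin : ∀ᵐ y ∂μ, ρ y < ∞ := by
    filter_upwards [hρ] with y hy
    exact hy.trans_lt ENNReal.ofReal_lt_top
  set f : Eu d → ℂ := fun y => ((ρ y).toReal : ℂ) with hf
  have hfm : Measurable f := Complex.measurable_ofReal.comp hρm.ennreal_toReal
  have hfρ : ∀ᵐ y ∂μ, ‖f y‖ₑ = ρ y := by
    filter_upwards [hfin] with y hy
    rw [hf, ← ofReal_norm, Complex.norm_real, Real.norm_of_nonneg ENNReal.toReal_nonneg,
      ENNReal.ofReal_toReal hy.ne]
  have hT : ∀ x, ∫ y, truncKernel k ε x y ∂g = truncOp k μ ε f x := fun x => by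
    rw [hgρ, integral_withDensity_eq_integral_toReal_smul hρm hfin, truncOp_eq_integral]
    refine integral_congr_ae (Filter.Eventually.of_forall fun y => ?_)
    simp only [hf, Complex.real_smul]
    ring
  have hint : ∫⁻ y, ‖f y‖ₑ ^ (2 : ℝ) ∂μ ≤ ENNReal.ofReal (M * t) * g Set.univ := by
    -- One factor of the density is bounded by `M * t`, which turns the `t ^ (-2)` of the weak
    -- `(2,2)` inequality into the required `t ^ (-1)`.
    calc ∫⁻ y, ‖f y‖ₑ ^ (2 : ℝ) ∂μ ≤ ∫⁻ y, ENNReal.ofReal (M * t) * ρ y ∂μ := by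
          refine lintegral_mono_ae ?_
          filter_upwards [hρ, hfρ] with y h1 h2
          rw [h2, ENNReal.rpow_two, sq]
          gcongr
      _ = ENNReal.ofReal (M * t) * g Set.univ := by
          rw [lintegral_const_mul _ hρm, hgρ, withDensity_apply _ MeasurableSet.univ,
            Measure.restrict_univ]
  have hfL : MemLp f (ENNReal.ofReal 2) μ := by
    rw [memLp_ofReal_iff (by norm_num)]
    exact ⟨hfm.aestronglyMeasurable, hint.trans_lt (by finiteness)⟩
  simp_rw [hT]
  refine (hC f hfL t ht).trans ?_
  rw [eLpNorm_ofReal_rpow (by norm_num)]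
  refine (mul_le_mul_right hint _).trans_eq ?_
  rw [ENNReal.ofReal_mul hM, Real.rpow_two, sq, ENNReal.ofReal_mul ht.le]
  have h1 : ENNReal.ofReal t ≠ 0 := by simpa using ht
  have h2 : ENNReal.ofReal t ≠ ∞ := ENNReal.ofReal_ne_top
  rw [div_eq_mul_inv, div_eq_mul_inv, ENNReal.mul_inv (Or.inl h1) (Or.inl h2)]
  calc _ = C * ENNReal.ofReal M * g Set.univ * (ENNReal.ofReal t)⁻¹ *
        ((ENNReal.ofReal t)⁻¹ * ENNReal.ofReal t) := by ring
    _ = _ := by rw [ENNReal.inv_mul_cancel h1 h2, mul_one]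

/-- The Calderón-Zygmund weak `(1,1)` theorem, for finite positive measures on the support of an
AD-regular measure. -/
theorem CZBound.exists_measure_potential_gt_le (hk : CZBound n c η k) (hn : 0 < n)
    [IsLocallyFiniteMeasure μ] (hμ : ADBound n a b μ) (hne : μ.support.Nonempty)
    (hν : HasGrowth n ν) (h2 : IsBoundedWeak k 2 μ ν) :
    ∃ C : ℝ≥0, ∀ ε : ℝ, 0 < ε → ∀ τ : Measure (Eu d), IsFiniteMeasure τ → τ μ.supportᶜ = 0 →
      ∀ t : ℝ, 0 < t → ν {x | t < ‖∫ y, truncKernel k ε x y ∂τ‖} ≤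
        C * τ Set.univ / ENNReal.ofReal t := by
  obtain ⟨C₂, hC₂⟩ := h2
  obtain ⟨cν, hcν, hν⟩ := hν
  obtain ⟨Cb, hCb, hbad⟩ := hk.lintegral_enorm_sub_le hn hcν hν
  have hc := hk.c_pos
  have ha := hμ.a_pos
  refine ⟨(cν * (2 ^ n * (1 + c))).toNNReal + (C₂ * (4 * a * 5 ^ n).toNNReal * 2 +
    (cν * 10 ^ n).toNNReal + Cb.toNNReal * 2), fun ε hε τ _ hτ t ht => ?_⟩
  have ht1 : ENNReal.ofReal t ≠ 0 := by simpa using ht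
  have ht2 : ENNReal.ofReal t ≠ ∞ := ENNReal.ofReal_ne_top
  rw [ENNReal.coe_add, add_mul, ENNReal.add_div]
  -- The decomposition needs its radii to be at most the diameter of the support. If this fails, `t`
  -- is so small that the size of the kernel alone confines the level set to one ball of the right
  -- `ν`-measure.
  by_cases hH : ∀ r : ℝ, 0 < r → ENNReal.ofReal (t * r ^ n) < τ Set.univ →
      ENNReal.ofReal r ≤ Metric.ediam μ.support
  swap
  · push Not at hH
    obtain ⟨r, hr, hrt, hd⟩ := hH
    exact (hk.measure_potential_gt_le_of_large hn hcν hν hε hτ hne ht hr hrt hd).trans le_self_add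
  refine le_trans ?_ le_add_self
  obtain ⟨u, r, τ₀, g, τ', γ, hu, hr, hsum, hmass, hmass', hτ'c, hγc, hτeq, hgeq, hgu, hgle⟩ :=
    hμ.exists_calderonZygmund_decomposition hn ht hτ hH
  have := hu.to_subtype
  have : IsFiniteMeasure g := ⟨by rw [hgu]; exact measure_lt_top _ _⟩
  have hτ'fin : ∀ i, IsFiniteMeasure (τ' i) := fun i =>
    ⟨(ENNReal.le_tsum i).trans_lt (hmass'.trans_lt (measure_lt_top _ _))⟩
  have hγfin : ∀ i, IsFiniteMeasure (γ i) := fun i => ⟨by rw [← hmass]; exact measure_lt_top _ _⟩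
  set Φ : u → Eu d → ℝ≥0∞ := fun i x =>
    ‖(∫ y, truncKernel k ε x y ∂τ' i) - ∫ y, truncKernel k ε x y ∂γ i‖ₑ with hΦ
  have hΦm : ∀ i, Measurable (Φ i) := fun i =>
    ((hk.measurable_potential hε _).sub (hk.measurable_potential hε _)).enorm
  -- The local measures live within `5 * r i` of the centre, and the cancellation estimate requires
  -- twice that distance.
  set Z := ⋃ i : u, Metric.closedBall (i : Eu d) (10 * r i) with hZ
  have hZm : MeasurableSet Z := MeasurableSet.iUnion fun i => Metric.isClosed_closedBall.measurableSet
  have hdiff : ∀ x, ‖(∫ y, truncKernel k ε x y ∂τ) - ∫ y, truncKernel k ε x y ∂g‖ₑ ≤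
      ∑' i, Φ i x := fun x => by
    have i1 := hk.integrable_truncKernel hn.le hε x τ
    have i2 := hk.integrable_truncKernel hn.le hε x g
    rw [hτeq] at i1 ⊢
    rw [hgeq] at i2 ⊢
    rw [← (hasSum_integral_sub_of_sum_measure i1 i2).tsum_eq]
    exact enorm_tsum_le_tsum_enorm
  have hsub : {x | t < ‖∫ y, truncKernel k ε x y ∂τ‖} ⊆
      {x | t / 2 < ‖∫ y, truncKernel k ε x y ∂g‖} ∪ Z ∪
        ({x | ENNReal.ofReal (t / 2) ≤ ∑' i, Φ i x} ∩ Zᶜ) := fun x hx => by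
    by_cases h1 : t / 2 < ‖∫ y, truncKernel k ε x y ∂g‖
    · exact Or.inl (Or.inl h1)
    by_cases h2 : x ∈ Z
    · exact Or.inl (Or.inr h2)
    refine Or.inr ⟨?_, h2⟩
    refine le_trans ?_ (hdiff x)
    rw [← ofReal_norm]
    refine ENNReal.ofReal_le_ofReal ?_
    have hx' : t < ‖∫ y, truncKernel k ε x y ∂τ‖ := hx
    have := norm_sub_norm_le (∫ y, truncKernel k ε x y ∂τ) (∫ y, truncKernel k ε x y ∂g)
    linarith
  have hgood : ν {x | t / 2 < ‖∫ y, truncKernel k ε x y ∂g‖} ≤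
      (C₂ * (4 * a * 5 ^ n).toNNReal * 2 : ℝ≥0) * τ Set.univ / ENNReal.ofReal t := by
    -- The level here is `t / 2`, so the density bound `2 * a * 5 ^ n * t` corresponds to `M = 4 * a
    -- * 5 ^ n`.
    have := measure_potential_gt_le_of_le_smul (ν := ν) (hC₂ ε hε) (g := g)
      (M := 4 * a * 5 ^ n) (by positivity) (half_pos ht) (by
        refine hgle.trans_eq ?_
        congr 2
        ring)
    refine this.trans_eq ?_
    rw [hgu, ENNReal.ofReal_div_of_pos (by norm_num), ENNReal.ofReal_ofNat, div_eq_mul_inv,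
      ENNReal.inv_div (by simp) (by simp), ENNReal.coe_mul, ENNReal.coe_mul, ← ENNReal.ofReal,
      ENNReal.coe_ofNat, div_eq_mul_inv, div_eq_mul_inv]
    ring
  have hZb : ν Z ≤ ((cν * 10 ^ n).toNNReal : ℝ≥0) * τ Set.univ / ENNReal.ofReal t := by
    rw [ENNReal.le_div_iff_mul_le (Or.inl ht1) (Or.inl ht2), ← ENNReal.ofReal]
    calc ν Z * ENNReal.ofReal t
        ≤ (∑' i : u, ν (Metric.closedBall (i : Eu d) (10 * r i))) * ENNReal.ofReal t := by
          gcongr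
          exact measure_iUnion_le _
      _ = ∑' i : u, ν (Metric.closedBall (i : Eu d) (10 * r i)) * ENNReal.ofReal t :=
          ENNReal.tsum_mul_right.symm
      _ ≤ ∑' i, ENNReal.ofReal (cν * 10 ^ n) * ENNReal.ofReal (t * r i ^ n) := by
          refine ENNReal.tsum_le_tsum fun i => ?_
          have h0 := hr i
          refine (mul_le_mul_left (hν _ _ (by positivity)) _).trans_eq ?_
          rw [← ENNReal.ofReal_mul (by positivity), ← ENNReal.ofReal_mul (by positivity),
            Real.mul_rpow (by norm_num) h0.le]
          congr 1
          ring
      _ = ENNReal.ofReal (cν * 10 ^ n) * ∑' i, ENNReal.ofReal (t * r i ^ n) :=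
          ENNReal.tsum_mul_left
      _ ≤ _ := mul_le_mul_right hsum _
  have hbadb : ν ({x | ENNReal.ofReal (t / 2) ≤ ∑' i, Φ i x} ∩ Zᶜ) ≤
      (Cb.toNNReal * 2 : ℝ≥0) * τ Set.univ / ENNReal.ofReal t := by
    rw [← Measure.restrict_apply' hZm.compl]
    refine (meas_ge_le_lintegral_div (Measurable.tsum hΦm).aemeasurable
      (by simpa using ht) ENNReal.ofReal_ne_top).trans ?_
    have hle : ∫⁻ x in Zᶜ, ∑' i, Φ i x ∂ν ≤ ENNReal.ofReal Cb * τ Set.univ := by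
      rw [lintegral_tsum fun i => (hΦm i).aemeasurable]
      calc ∑' i, ∫⁻ x in Zᶜ, Φ i x ∂ν ≤ ∑' i, ENNReal.ofReal Cb * τ' i Set.univ := by
            refine ENNReal.tsum_le_tsum fun i => ?_
            have h0 := hr i
            refine le_trans (lintegral_mono_set fun x hx => ?_)
              (hbad ε (5 * r i) i (τ' i) (γ i) hε (by positivity) (hτ'fin i) (hγfin i) (hmass i)
                (hτ'c i) (hγc i))
            have : x ∉ Metric.closedBall (i : Eu d) (10 * r i) := fun h =>
              hx (Set.mem_iUnion.2 ⟨i, h⟩)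
            rw [mem_closedBall_iff_norm', not_le] at this
            change 2 * (5 * r i) ≤ ‖(i : Eu d) - x‖
            linarith
        _ = ENNReal.ofReal Cb * ∑' i, τ' i Set.univ := ENNReal.tsum_mul_left
        _ ≤ _ := mul_le_mul_right hmass' _
    refine (ENNReal.div_le_div_right hle _).trans_eq ?_
    rw [ENNReal.ofReal_div_of_pos (by norm_num), ENNReal.ofReal_ofNat, div_eq_mul_inv,
      ENNReal.inv_div (by simp) (by simp), ENNReal.coe_mul, ← ENNReal.ofReal,
      ENNReal.coe_ofNat, div_eq_mul_inv, div_eq_mul_inv]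
    ring
  calc _ ≤ _ := measure_mono hsub
    _ ≤ _ := (measure_union_le _ _).trans (add_le_add (measure_union_le _ _) le_rfl)
    _ ≤ _ := add_le_add (add_le_add hgood hZb) hbadb
    _ = _ := by
        rw [ENNReal.coe_add, ENNReal.coe_add, add_mul, add_mul, ENNReal.add_div, ENNReal.add_div]

end

/-! ### Complex measures and complex densities. -/

/-- Integration of bounded functions against a complex measure, in terms of a decomposition into
four positive measures. -/
theorem vectorMeasure_integral_eq_of_apply_eq {α : Type*} [MeasurableSpace α]
    {σ : ComplexMeasure α} {τ₁ τ₂ τ₃ τ₄ : Measure α} [IsFiniteMeasure τ₁] [IsFiniteMeasure τ₂]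
    [IsFiniteMeasure τ₃] [IsFiniteMeasure τ₄]
    (h : ∀ s, MeasurableSet s → σ s =
      (τ₁.real s - τ₂.real s : ℂ) + Complex.I * (τ₃.real s - τ₄.real s))
    {f : α → ℂ} (hf : StronglyMeasurable f) {C : ℝ} (hC : ∀ x, ‖f x‖ ≤ C) :
    VectorMeasure.integral σ f (ContinuousLinearMap.mul ℝ ℂ) =
      ((∫ y, f y ∂τ₁) - ∫ y, f y ∂τ₂) + Complex.I * ((∫ y, f y ∂τ₃) - ∫ y, f y ∂τ₄) := by
  -- This makes the variation finite, so that bounded functions are integrable against `σ` and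
  -- dominated convergence carries the identity from simple functions to `f`.
  have hvar : σ.variation ≤ τ₁ + τ₂ + (τ₃ + τ₄) := by
    refine VectorMeasure.variation_le_of_forall_enorm_le fun s hs => ?_
    have h0 : ∀ τ : Measure α, IsFiniteMeasure τ → ‖(τ.real s : ℂ)‖ₑ = τ s := fun τ _ => by
      rw [← ofReal_norm, Complex.norm_real, Real.norm_of_nonneg measureReal_nonneg,
        ofReal_measureReal]
    rw [h s hs]
    simp only [Measure.add_apply]
    refine (enorm_add_le _ _).trans (add_le_add ?_ ?_)
    · rw [← h0 τ₁ inferInstance, ← h0 τ₂ inferInstance]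
      exact enorm_sub_le
    · rw [enorm_mul, ← ofReal_norm Complex.I, Complex.norm_I, ENNReal.ofReal_one, one_mul,
        ← h0 τ₃ inferInstance, ← h0 τ₄ inferInstance]
      exact enorm_sub_le
  have : IsFiniteMeasure σ.variation := isFiniteMeasure_of_le _ hvar
  have hsimple : ∀ g : SimpleFunc α ℂ,
      VectorMeasure.integral σ g (ContinuousLinearMap.mul ℝ ℂ) =
      ((∫ y, g y ∂τ₁) - ∫ y, g y ∂τ₂) + Complex.I * ((∫ y, g y ∂τ₃) - ∫ y, g y ∂τ₄) := fun g => by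
    induction g using SimpleFunc.induction with
    | @const c s hs =>
      have hind : ⇑(SimpleFunc.piecewise s hs (SimpleFunc.const α c) (SimpleFunc.const α 0)) =
          s.indicator fun _ => c := by
        ext x
        by_cases hx : x ∈ s <;> simp [hx]
      have hfin : IsFiniteMeasure (σ.restrict s).variation := by
        rw [VectorMeasure.variation_restrict hs]
        infer_instance
      rw [hind, VectorMeasure.integral_indicator hs, VectorMeasure.integral_const]
      simp_rw [integral_indicator_const c hs]
      rw [VectorMeasure.restrict_apply _ hs MeasurableSet.univ, Set.univ_inter, h s hs]
      simp only [ContinuousLinearMap.mul_apply', Complex.real_smul]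
      ring
    | @add f g _ hf hg =>
      have hi : ∀ (φ : SimpleFunc α ℂ) (τ : Measure α), IsFiniteMeasure τ → Integrable φ τ :=
        fun φ τ _ => φ.integrable_of_isFiniteMeasure
      rw [SimpleFunc.coe_add]
      simp_rw [Pi.add_apply]
      rw [VectorMeasure.integral_add (hi f _ inferInstance) (hi g _ inferInstance), hf, hg]
      rw [integral_add (hi f τ₁ inferInstance) (hi g τ₁ inferInstance),
        integral_add (hi f τ₂ inferInstance) (hi g τ₂ inferInstance),
        integral_add (hi f τ₃ inferInstance) (hi g τ₃ inferInstance),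
        integral_add (hi f τ₄ inferInstance) (hi g τ₄ inferInstance)]
      ring
  have hC0 : 0 ≤ max C 0 := le_max_right _ _
  have hlim : ∀ x, Filter.Tendsto (fun m => hf.approxBounded (max C 0) m x) Filter.atTop (nhds (f x)) :=
    fun x => hf.tendsto_approxBounded_of_norm_le ((hC x).trans (le_max_left _ _))
  have hlim' : ∀ τ : Measure α, IsFiniteMeasure τ → Filter.Tendsto
      (fun m => ∫ y, hf.approxBounded (max C 0) m y ∂τ) Filter.atTop (nhds (∫ y, f y ∂τ)) := fun τ _ =>
    tendsto_integral_of_dominated_convergence (fun _ => max C 0)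
      (fun m => (hf.approxBounded (max C 0) m).aestronglyMeasurable) (integrable_const _)
      (fun m => Filter.Eventually.of_forall fun x => hf.norm_approxBounded_le hC0 m x)
      (Filter.Eventually.of_forall hlim)
  refine tendsto_nhds_unique (VectorMeasure.tendsto_integral_of_dominated_convergence
    (fun _ => max C 0)
      (fun m => (hf.approxBounded (max C 0) m).aestronglyMeasurable) (integrable_const _)
      (fun m => Filter.Eventually.of_forall fun x => hf.norm_approxBounded_le hC0 m x)
      (Filter.Eventually.of_forall hlim)) ?_
  simp_rw [hsimple]
  exact ((hlim' τ₁ inferInstance).sub (hlim' τ₂ inferInstance)).add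
    (((hlim' τ₃ inferInstance).sub (hlim' τ₄ inferInstance)).const_mul _)

/-- Every complex measure splits into four positive measures dominated by its variation. -/
theorem ComplexMeasure.exists_four_measures {α : Type*} [MeasurableSpace α]
    (σ : ComplexMeasure α) : ∃ τ : Fin 4 → Measure α, (∀ j, IsFiniteMeasure (τ j)) ∧
      (∀ j, τ j ≤ σ.variation) ∧ ∀ s, MeasurableSet s → σ s =
      ((τ 0).real s - (τ 1).real s : ℂ) + Complex.I * ((τ 2).real s - (τ 3).real s) := by
  set r := ComplexMeasure.re σ with hr
  set i := ComplexMeasure.im σ with hi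
  have hle : ∀ s : SignedMeasure α, (∀ E, MeasurableSet E → |s E| ≤ ‖σ E‖) →
      s.totalVariation ≤ σ.variation := fun s hs => by
    rw [SignedMeasure.totalVariation_eq_variation]
    refine VectorMeasure.variation_le_of_forall_enorm_le fun E hE => ?_
    refine le_trans ?_ (VectorMeasure.enorm_measure_le_variation σ E)
    rw [← ofReal_norm, ← ofReal_norm]
    exact ENNReal.ofReal_le_ofReal (hs E hE)
  have hre : ∀ E, r E = (σ E).re := fun E => rfl
  have him : ∀ E, i E = (σ E).im := fun E => rfl
  have hrle := hle r fun E _ => by rw [hre]; exact Complex.abs_re_le_norm _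
  have hile := hle i fun E _ => by rw [him]; exact Complex.abs_im_le_norm _
  refine ⟨![r.toJordanDecomposition.posPart, r.toJordanDecomposition.negPart,
    i.toJordanDecomposition.posPart, i.toJordanDecomposition.negPart], ?_, ?_, fun s hs => ?_⟩
  · intro j
    fin_cases j <;> simp <;> infer_instance
  · intro j
    fin_cases j
    · exact (Measure.le_add_right le_rfl).trans hrle
    · exact (Measure.le_add_left le_rfl).trans hrle
    · exact (Measure.le_add_right le_rfl).trans hile
    · exact (Measure.le_add_left le_rfl).trans hile
  · have h1 := r.apply_eq_posPart_real_sub_negPart_real hs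
    have h2 := i.apply_eq_posPart_real_sub_negPart_real hs
    rw [hre] at h1
    rw [him] at h2
    simp only [Matrix.cons_val_zero, Matrix.cons_val_one, Matrix.cons_val]
    rw [← Complex.ofReal_sub, ← Complex.ofReal_sub, ← h1, ← h2, mul_comm, Complex.re_add_im]

theorem measure_gt_le_of_four {α : Type*} [MeasurableSpace α] {ν : Measure α} {F : α → ℂ}
    {P : Fin 4 → α → ℂ} (hF : ∀ x, F x = (P 0 x - P 1 x) + Complex.I * (P 2 x - P 3 x))
    {M : ℝ≥0∞} (hP : ∀ j, ∀ t : ℝ, 0 < t → ν {x | t < ‖P j x‖} ≤ M / ENNReal.ofReal t)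
    {t : ℝ} (ht : 0 < t) : ν {x | t < ‖F x‖} ≤ 16 * M / ENNReal.ofReal t := by
  have hsub : {x | t < ‖F x‖} ⊆ ⋃ j : Fin 4, {x | t / 4 < ‖P j x‖} := fun x hx => by
    by_contra hcon
    simp only [Set.mem_iUnion, not_exists] at hcon
    have h : ∀ j, ‖P j x‖ ≤ t / 4 := fun j => not_lt.1 (hcon j)
    have hx' : t < ‖F x‖ := hx
    rw [hF] at hx'
    have h1 := norm_add_le (P 0 x - P 1 x) (Complex.I * (P 2 x - P 3 x))
    rw [norm_mul, Complex.norm_I, one_mul] at h1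
    have h2 := norm_sub_le (P 0 x) (P 1 x)
    have h3 := norm_sub_le (P 2 x) (P 3 x)
    linarith [h 0, h 1, h 2, h 3]
  refine (measure_mono hsub).trans ((measure_iUnion_le _).trans ?_)
  rw [tsum_fintype]
  refine (Finset.sum_le_sum fun j _ => hP j (t / 4) (by positivity)).trans_eq ?_
  rw [Finset.sum_const, Finset.card_univ, Fintype.card_fin, nsmul_eq_mul,
    ENNReal.ofReal_div_of_pos (by norm_num), ENNReal.ofReal_ofNat, div_eq_mul_inv,
    ENNReal.inv_div (by simp) (by simp), div_eq_mul_inv, div_eq_mul_inv]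
  push_cast
  ring

section
variable {d : ℕ} {n c η a b : ℝ} {k : Eu d → Eu d → ℂ} {μ ν : Measure (Eu d)}

/-- The four positive parts are dominated by the variation, so they vanish off `K` as well and the
estimate for positive measures applies to each. The constant `16` comes from four terms, each at
level `t / 4`. -/
theorem CZBound.isBoundedMeasureWeak (hk : CZBound n c η k) (hn : 0 ≤ n) {K : Set (Eu d)} {C : ℝ≥0}
    (hC : ∀ ε : ℝ, 0 < ε → ∀ τ : Measure (Eu d), IsFiniteMeasure τ → τ Kᶜ = 0 →
      ∀ t : ℝ, 0 < t → ν {x | t < ‖∫ y, truncKernel k ε x y ∂τ‖} ≤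
        C * τ Set.univ / ENNReal.ofReal t) : IsBoundedMeasureWeak k K ν := by
  refine ⟨16 * C, fun ε hε σ hσ t ht => ?_⟩
  obtain ⟨τ, hfin, hle, happ⟩ := ComplexMeasure.exists_four_measures σ
  have := hfin 0
  have := hfin 1
  have := hfin 2
  have := hfin 3
  have hF : ∀ x, truncOpMeasure k ε σ x =
      ((∫ y, truncKernel k ε x y ∂τ 0) - ∫ y, truncKernel k ε x y ∂τ 1) +
      Complex.I * ((∫ y, truncKernel k ε x y ∂τ 2) - ∫ y, truncKernel k ε x y ∂τ 3) := fun x => by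
    rw [truncOpMeasure, ← VectorMeasure.integral_indicator (measurableSet_far ε x)]
    exact vectorMeasure_integral_eq_of_apply_eq happ
      (hk.measurable_truncKernel_right hε x).stronglyMeasurable
      (hk.norm_truncKernel_le_const hn hε x)
  refine (measure_gt_le_of_four (P := fun j x => ∫ y, truncKernel k ε x y ∂τ j) hF
    (M := C * σ.variation Set.univ) (fun j s hs => ?_) ht).trans_eq ?_
  · refine (hC ε hε (τ j) (hfin j) (nonpos_iff_eq_zero.1 ((hle j _).trans_eq hσ)) s hs).trans ?_
    gcongr
    exact hle j
  · rw [← mul_assoc]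
    rfl

theorem CZBound.integral_truncKernel_mul_ofReal (hk : CZBound n c η k) (hn : 0 ≤ n) {ε : ℝ}
    (hε : 0 < ε) {φ : Eu d → ℝ} (hφ : Integrable φ μ) (x : Eu d) :
    ∫ y, truncKernel k ε x y * (φ y : ℂ) ∂μ =
      (∫ y, truncKernel k ε x y ∂μ.withDensity fun y => ENNReal.ofReal (φ y)) -
      ∫ y, truncKernel k ε x y ∂μ.withDensity fun y => ENNReal.ofReal (-φ y) := by
  have hform : ∀ ψ : Eu d → ℝ, Integrable ψ μ →
      ∫ y, truncKernel k ε x y ∂(μ.withDensity fun y => ENNReal.ofReal (ψ y)) =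
        ∫ y, ((max (ψ y) 0 : ℝ) : ℂ) * truncKernel k ε x y ∂μ := fun ψ hψ => by
    rw [integral_withDensity_eq_integral_toReal_smul₀ hψ.1.aemeasurable.ennreal_ofReal
      (Filter.Eventually.of_forall fun _ => ENNReal.ofReal_lt_top)]
    refine integral_congr_ae (Filter.Eventually.of_forall fun y => ?_)
    simp only [ENNReal.toReal_ofReal', Complex.real_smul]
  have hint : ∀ ψ : Eu d → ℝ, Integrable ψ μ →
      Integrable (fun y => ((max (ψ y) 0 : ℝ) : ℂ) * truncKernel k ε x y) μ := fun ψ hψ =>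
    hψ.pos_part.ofReal.mul_bdd (c := c / ε ^ n)
      (hk.measurable_truncKernel_right hε x).aestronglyMeasurable
      (Filter.Eventually.of_forall (hk.norm_truncKernel_le_const hn hε x))
  have hneg : Integrable (fun y => -φ y) μ := hφ.neg
  rw [hform φ hφ, hform _ hneg, ← integral_sub (hint φ hφ) (hint _ hneg)]
  refine integral_congr_ae (Filter.Eventually.of_forall fun y => ?_)
  have : φ y = max (φ y) 0 - max (-φ y) 0 := by
    rcases le_total 0 (φ y) with h | h
    · rw [max_eq_left h, max_eq_right (by linarith), sub_zero]
    · rw [max_eq_right h, max_eq_left (by linarith), zero_sub, neg_neg]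
  simp only
  conv_lhs => rw [this]
  push_cast
  ring

/-- An integrable function is a combination of four positive densities with respect to `μ`, each
giving a finite measure carried by the support. This is the `L^1` endpoint for interpolation. -/
theorem CZBound.isBoundedWeak_one (hk : CZBound n c η k) (hn : 0 ≤ n) {C : ℝ≥0}
    (hC : ∀ ε : ℝ, 0 < ε → ∀ τ : Measure (Eu d), IsFiniteMeasure τ → τ μ.supportᶜ = 0 →
      ∀ t : ℝ, 0 < t → ν {x | t < ‖∫ y, truncKernel k ε x y ∂τ‖} ≤
        C * τ Set.univ / ENNReal.ofReal t) : IsBoundedWeak k 1 μ ν := by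
  refine ⟨16 * C, fun ε hε f hf t ht => ?_⟩
  rw [ENNReal.ofReal_one, memLp_one_iff_integrable] at hf
  set φ : Fin 4 → Eu d → ℝ := ![fun y => (f y).re, fun y => -(f y).re, fun y => (f y).im,
    fun y => -(f y).im] with hφ
  have hφle : ∀ j y, φ j y ≤ ‖f y‖ := fun j y => by
    fin_cases j
    · exact (le_abs_self _).trans (Complex.abs_re_le_norm _)
    · exact (neg_le_abs _).trans (Complex.abs_re_le_norm _)
    · exact (le_abs_self _).trans (Complex.abs_im_le_norm _)
    · exact (neg_le_abs _).trans (Complex.abs_im_le_norm _)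
  set τ : Fin 4 → Measure (Eu d) := fun j => μ.withDensity fun y => ENNReal.ofReal (φ j y) with hτ
  have hmass : ∀ j, τ j Set.univ ≤ ∫⁻ y, ‖f y‖ₑ ∂μ := fun j => by
    rw [hτ, withDensity_apply _ MeasurableSet.univ, Measure.restrict_univ]
    refine lintegral_mono fun y => ?_
    rw [← ofReal_norm]
    exact ENNReal.ofReal_le_ofReal (hφle j y)
  have hF : ∀ x, truncOp k μ ε f x =
      ((∫ y, truncKernel k ε x y ∂τ 0) - ∫ y, truncKernel k ε x y ∂τ 1) +
      Complex.I * ((∫ y, truncKernel k ε x y ∂τ 2) - ∫ y, truncKernel k ε x y ∂τ 3) := fun x => by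
    have hre : Integrable (fun y => (f y).re) μ := hf.re
    have him : Integrable (fun y => (f y).im) μ := hf.im
    have h1 := hk.integral_truncKernel_mul_ofReal hn hε hre x
    have h2 := hk.integral_truncKernel_mul_ofReal hn hε him x
    have hint : ∀ ψ : Eu d → ℝ, Integrable ψ μ →
        Integrable (fun y => truncKernel k ε x y * (ψ y : ℂ)) μ := fun ψ hψ =>
      hψ.ofReal.bdd_mul (c := c / ε ^ n)
        (hk.measurable_truncKernel_right hε x).aestronglyMeasurable
        (Filter.Eventually.of_forall (hk.norm_truncKernel_le_const hn hε x))
    calc truncOp k μ ε f x = ∫ y, (truncKernel k ε x y * (((f y).re : ℝ) : ℂ) +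
          Complex.I * (truncKernel k ε x y * (((f y).im : ℝ) : ℂ))) ∂μ := by
          rw [truncOp_eq_integral]
          refine integral_congr_ae (Filter.Eventually.of_forall fun y => ?_)
          simp only
          conv_lhs => rw [← Complex.re_add_im (f y)]
          ring
      _ = _ := by
          rw [integral_add (hint _ hre) ((hint _ him).const_mul _), integral_const_mul]
          exact congrArg₂ (fun z w => z + Complex.I * w) h1 h2
  refine (measure_gt_le_of_four (P := fun j x => ∫ y, truncKernel k ε x y ∂τ j) hF
    (M := C * ∫⁻ y, ‖f y‖ₑ ∂μ) (fun j s hs => ?_) ht).trans_eq ?_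
  · have : IsFiniteMeasure (τ j) := ⟨(hmass j).trans_lt hf.2⟩
    refine (hC ε hε (τ j) this (withDensity_absolutelyContinuous _ _
      Measure.measure_compl_support) s hs).trans ?_
    gcongr
    exact hmass j
  · rw [eLpNorm_ofReal_rpow one_pos, Real.rpow_one]
    simp only [ENNReal.rpow_one, ENNReal.coe_mul, ENNReal.coe_ofNat, div_eq_mul_inv]
    ring

end

/-! ### Marcinkiewicz interpolation. -/

theorem setLIntegral_Ioc_rpow_le {p s : ℝ} (hp : 1 < p) (hs : 0 ≤ s) :
    ∫⁻ t in Set.Ioc 0 s, ENNReal.ofReal (t ^ (p - 2)) = ENNReal.ofReal (s ^ (p - 1) / (p - 1)) := by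
  have hint : IntegrableOn (fun t : ℝ => t ^ (p - 2)) (Set.Ioc 0 s) :=
    (intervalIntegrable_iff_integrableOn_Ioc_of_le hs).1
      (intervalIntegral.intervalIntegrable_rpow' (by linarith))
  rw [← ofReal_integral_eq_lintegral_ofReal hint, ← intervalIntegral.integral_of_le hs,
    integral_rpow (Or.inl (by linarith))]
  · rw [show p - 2 + 1 = p - 1 by ring, Real.zero_rpow (by linarith), sub_zero]
  · filter_upwards [ae_restrict_mem measurableSet_Ioc] with t ht
    exact Real.rpow_nonneg ht.1.le _

theorem setLIntegral_Ioi_rpow_eq {p q s : ℝ} (hpq : p < q) (hs : 0 < s) :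
    ∫⁻ t in Set.Ioi s, ENNReal.ofReal (t ^ (p - 1 - q)) =
      ENNReal.ofReal (s ^ (p - q) / (q - p)) := by
  rw [← ofReal_integral_eq_lintegral_ofReal (integrableOn_Ioi_rpow_of_lt (by linarith) hs),
    integral_Ioi_rpow_of_lt (by linarith) hs]
  · rw [show p - 1 - q + 1 = p - q by ring, neg_div, ← div_neg, neg_sub]
  · filter_upwards [ae_restrict_mem measurableSet_Ioi] with t ht
    exact Real.rpow_nonneg (hs.le.trans (Set.mem_Ioi.1 ht).le) _

/-- Real interpolation: the strong `(p,p)` bound from a distributional inequality of the form given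
by weak type `(1,1)` and weak type `(q,q)` bounds. -/
theorem lintegral_rpow_le_of_distribution_le {α β : Type*} [MeasurableSpace α] [MeasurableSpace β]
    {μ : Measure α} [SFinite μ] {ν : Measure β} {f : α → ℂ} (hf : Measurable f) {g : β → ℂ}
    (hg : AEMeasurable g ν) {p q : ℝ} (hp : 1 < p) (hpq : p < q) {C₁ C₂ : ℝ≥0∞}
    (h : ∀ t : ℝ, 0 < t → ν {x | t < ‖g x‖} ≤
      C₁ / ENNReal.ofReal t * ∫⁻ y in {y | t ≤ ‖f y‖}, ‖f y‖ₑ ∂μ +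
      C₂ / ENNReal.ofReal (t ^ q) * ∫⁻ y in {y | ‖f y‖ < t}, ‖f y‖ₑ ^ q ∂μ) :
    ∫⁻ x, ‖g x‖ₑ ^ p ∂ν ≤ (ENNReal.ofReal (p / (p - 1)) * C₁ + ENNReal.ofReal (p / (q - p)) * C₂) *
      ∫⁻ y, ‖f y‖ₑ ^ p ∂μ := by
  have hp0 : 0 < p := by linarith
  have hq0 : 0 < q := by linarith
  have hp1 : 0 < p - 1 := by linarith
  have hqp : 0 < q - p := by linarith
  have hfn : Measurable fun y => ‖f y‖ := hf.norm
  -- The layer-cake formula multiplies the two weak-type terms by `t ^ (p - 1)`. Writing the results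
  -- as indicators on the product space makes them jointly measurable, so Tonelli allows integrating
  -- in `t` first: over `(0, |f y|]` here, and over `(|f y|, ∞)` for `F₂`.
  set F₁ : ℝ → α → ℝ≥0∞ := fun t y =>
    ({z : ℝ × α | z.1 ≤ ‖f z.2‖}.indicator
      (fun z => ‖f z.2‖ₑ * ENNReal.ofReal (z.1 ^ (p - 2)))) (t, y) with hF₁
  set F₂ : ℝ → α → ℝ≥0∞ := fun t y =>
    ({z : ℝ × α | ‖f z.2‖ < z.1}.indicator
      (fun z => ‖f z.2‖ₑ ^ q * ENNReal.ofReal (z.1 ^ (p - 1 - q)))) (t, y) with hF₂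
  have hF₁m : Measurable (Function.uncurry F₁) := by
    refine Measurable.indicator ?_ (measurableSet_le measurable_fst (hfn.comp measurable_snd))
    exact (hf.comp measurable_snd).enorm.mul (measurable_fst.pow_const _).ennreal_ofReal
  have hF₂m : Measurable (Function.uncurry F₂) := by
    refine Measurable.indicator ?_ (measurableSet_lt (hfn.comp measurable_snd) measurable_fst)
    exact ((hf.comp measurable_snd).enorm.pow_const q).mul
      (measurable_fst.pow_const _).ennreal_ofReal
  have hi₁ : ∀ y, ∫⁻ t in Set.Ioi 0, F₁ t y ≤ ENNReal.ofReal (1 / (p - 1)) * ‖f y‖ₑ ^ p := fun y => by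
    calc ∫⁻ t in Set.Ioi 0, F₁ t y = ∫⁻ t in Set.Ioi 0, (Set.Iic ‖f y‖).indicator
          (fun t => ‖f y‖ₑ * ENNReal.ofReal (t ^ (p - 2))) t := rfl
      _ = ‖f y‖ₑ * ∫⁻ t in Set.Ioc 0 ‖f y‖, ENNReal.ofReal (t ^ (p - 2)) := by
          rw [setLIntegral_indicator measurableSet_Iic, Set.inter_comm, Set.Ioi_inter_Iic,
            lintegral_const_mul' _ _ enorm_ne_top]
      _ = ENNReal.ofReal (1 / (p - 1)) * ‖f y‖ₑ ^ p := by
          rw [setLIntegral_Ioc_rpow_le hp (norm_nonneg _), ← ofReal_norm,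
            ENNReal.ofReal_rpow_of_nonneg (norm_nonneg _) hp0.le,
            ← ENNReal.ofReal_mul (norm_nonneg _), ← ENNReal.ofReal_mul (by positivity)]
          congr 1
          rcases (norm_nonneg (f y)).eq_or_lt with h0 | h0
          · rw [← h0, Real.zero_rpow hp0.ne']
            ring
          · rw [Real.rpow_sub_one h0.ne']
            field_simp
      _ ≤ _ := le_rfl
  have hi₂ : ∀ y, ∫⁻ t in Set.Ioi 0, F₂ t y ≤ ENNReal.ofReal (1 / (q - p)) * ‖f y‖ₑ ^ p := fun y => by
    calc ∫⁻ t in Set.Ioi 0, F₂ t y = ∫⁻ t in Set.Ioi 0, (Set.Ioi ‖f y‖).indicator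
          (fun t => ‖f y‖ₑ ^ q * ENNReal.ofReal (t ^ (p - 1 - q))) t := rfl
      _ = ‖f y‖ₑ ^ q * ∫⁻ t in Set.Ioi ‖f y‖, ENNReal.ofReal (t ^ (p - 1 - q)) := by
          rw [setLIntegral_indicator measurableSet_Ioi, Set.Ioi_inter_Ioi,
            max_eq_left (norm_nonneg _), lintegral_const_mul' _ _ (by finiteness)]
      _ ≤ _ := by
          rcases (norm_nonneg (f y)).eq_or_lt with h0 | h0
          · rw [← ofReal_norm, ← h0, ENNReal.ofReal_zero, ENNReal.zero_rpow_of_pos hq0, zero_mul]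
            exact zero_le
          · rw [setLIntegral_Ioi_rpow_eq hpq h0, ← ofReal_norm,
              ENNReal.ofReal_rpow_of_nonneg (norm_nonneg _) hp0.le,
              ENNReal.ofReal_rpow_of_nonneg (norm_nonneg _) hq0.le,
              ← ENNReal.ofReal_mul (by positivity), ← ENNReal.ofReal_mul (by positivity)]
            refine ENNReal.ofReal_le_ofReal (le_of_eq ?_)
            rw [Real.rpow_sub h0]
            field_simp
  have hS₁ : ∀ t : ℝ, 0 < t → C₁ / ENNReal.ofReal t * (∫⁻ y in {y | t ≤ ‖f y‖}, ‖f y‖ₑ ∂μ) *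
      ENNReal.ofReal (t ^ (p - 1)) = C₁ * ∫⁻ y, F₁ t y ∂μ := fun t ht => by
    have : ∀ y, F₁ t y = {y | t ≤ ‖f y‖}.indicator
        (fun y => ‖f y‖ₑ * ENNReal.ofReal (t ^ (p - 2))) y := fun y => rfl
    simp_rw [this]
    have hpow : t ^ (p - 2) = t ^ (p - 1) / t := by
      rw [← Real.rpow_sub_one ht.ne']
      ring_nf
    rw [lintegral_indicator (measurableSet_le measurable_const hfn),
      lintegral_mul_const' _ _ ENNReal.ofReal_ne_top, hpow, ENNReal.ofReal_div_of_pos ht,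
      div_eq_mul_inv, div_eq_mul_inv]
    ring
  have hS₂ : ∀ t : ℝ, 0 < t → C₂ / ENNReal.ofReal (t ^ q) *
      (∫⁻ y in {y | ‖f y‖ < t}, ‖f y‖ₑ ^ q ∂μ) *
      ENNReal.ofReal (t ^ (p - 1)) = C₂ * ∫⁻ y, F₂ t y ∂μ := fun t ht => by
    have : ∀ y, F₂ t y = {y | ‖f y‖ < t}.indicator
        (fun y => ‖f y‖ₑ ^ q * ENNReal.ofReal (t ^ (p - 1 - q))) y := fun y => rfl
    simp_rw [this]
    rw [lintegral_indicator (measurableSet_lt hfn measurable_const),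
      lintegral_mul_const' _ _ ENNReal.ofReal_ne_top, Real.rpow_sub ht (p - 1) q,
      ENNReal.ofReal_div_of_pos (by positivity), div_eq_mul_inv, div_eq_mul_inv]
    ring
  have hlayer := lintegral_rpow_eq_lintegral_meas_lt_mul ν (f := fun x => ‖g x‖)
    (Filter.Eventually.of_forall fun x => norm_nonneg _) hg.norm hp0
  calc ∫⁻ x, ‖g x‖ₑ ^ p ∂ν = ∫⁻ x, ENNReal.ofReal (‖g x‖ ^ p) ∂ν := by
        refine lintegral_congr fun x => ?_
        rw [← ofReal_norm, ENNReal.ofReal_rpow_of_nonneg (norm_nonneg _) hp0.le]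
    _ = _ := hlayer
    _ ≤ ENNReal.ofReal p * ∫⁻ t in Set.Ioi 0,
          (C₁ * (∫⁻ y, F₁ t y ∂μ) + C₂ * (∫⁻ y, F₂ t y ∂μ)) := by
        refine mul_le_mul_right (setLIntegral_mono' measurableSet_Ioi fun t ht => ?_) _
        rw [← hS₁ t ht, ← hS₂ t ht, ← add_mul]
        exact mul_le_mul_left (h t ht) _
    _ = ENNReal.ofReal p * (C₁ * (∫⁻ t in Set.Ioi 0, (∫⁻ y, F₁ t y ∂μ)) +
          C₂ * (∫⁻ t in Set.Ioi 0, (∫⁻ y, F₂ t y ∂μ))) := by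
        have m₁ : Measurable fun t => ∫⁻ y, F₁ t y ∂μ := hF₁m.lintegral_prod_right
        have m₂ : Measurable fun t => ∫⁻ y, F₂ t y ∂μ := hF₂m.lintegral_prod_right
        rw [lintegral_add_left (m₁.const_mul _), lintegral_const_mul _ m₁, lintegral_const_mul _ m₂]
    _ = ENNReal.ofReal p * (C₁ * (∫⁻ y, (∫⁻ t in Set.Ioi 0, F₁ t y) ∂μ) +
          C₂ * (∫⁻ y, (∫⁻ t in Set.Ioi 0, F₂ t y) ∂μ)) := by
        rw [lintegral_lintegral_swap hF₁m.aemeasurable, lintegral_lintegral_swap hF₂m.aemeasurable]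
    _ ≤ ENNReal.ofReal p * (C₁ * (∫⁻ y, ENNReal.ofReal (1 / (p - 1)) * ‖f y‖ₑ ^ p ∂μ) +
          C₂ * (∫⁻ y, ENNReal.ofReal (1 / (q - p)) * ‖f y‖ₑ ^ p ∂μ)) := by
        gcongr with y y
        · exact hi₁ y
        · exact hi₂ y
    _ = _ := by
        rw [lintegral_const_mul' _ _ ENNReal.ofReal_ne_top,
          lintegral_const_mul' _ _ ENNReal.ofReal_ne_top, ← mul_one_div p, ← mul_one_div p,
          ENNReal.ofReal_mul hp0.le, ENNReal.ofReal_mul hp0.le]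
        ring

section
variable {d : ℕ} {n c η p q : ℝ} {k : Eu d → Eu d → ℂ} {μ ν : Measure (Eu d)}

theorem enorm_rpow_le_of_le_norm {z : ℂ} {r s t : ℝ} (ht : 0 < t) (hr : r ≤ s)
    (hz : t ≤ ‖z‖) : ‖z‖ₑ ^ r ≤ ENNReal.ofReal (t ^ (r - s)) * ‖z‖ₑ ^ s := by
  have hz0 : 0 < ‖z‖ := ht.trans_le hz
  rw [← ofReal_norm, ENNReal.ofReal_rpow_of_pos hz0, ENNReal.ofReal_rpow_of_pos hz0,
    ← ENNReal.ofReal_mul (by positivity)]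
  refine ENNReal.ofReal_le_ofReal ?_
  calc ‖z‖ ^ r = ‖z‖ ^ (r - s) * ‖z‖ ^ s := by rw [← Real.rpow_add hz0]; ring_nf
    _ ≤ _ := by
        refine mul_le_mul_of_nonneg_right ?_ (by positivity)
        exact Real.rpow_le_rpow_of_nonpos ht hz (by linarith)

theorem enorm_rpow_le_of_norm_le {z : ℂ} {r s t : ℝ} (ht : 0 < t) (hs : 0 < s) (hr : s ≤ r)
    (hz : ‖z‖ ≤ t) : ‖z‖ₑ ^ r ≤ ENNReal.ofReal (t ^ (r - s)) * ‖z‖ₑ ^ s := by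
  rcases (norm_nonneg z).eq_or_lt with h0 | h0
  · rw [← ofReal_norm, ← h0, ENNReal.ofReal_zero, ENNReal.zero_rpow_of_pos (hs.trans_le hr)]
    exact zero_le
  rw [← ofReal_norm, ENNReal.ofReal_rpow_of_pos h0, ENNReal.ofReal_rpow_of_pos h0,
    ← ENNReal.ofReal_mul (by positivity)]
  refine ENNReal.ofReal_le_ofReal ?_
  calc ‖z‖ ^ r = ‖z‖ ^ (r - s) * ‖z‖ ^ s := by rw [← Real.rpow_add h0]; ring_nf
    _ ≤ _ := by
        refine mul_le_mul_of_nonneg_right ?_ (by positivity)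
        exact Real.rpow_le_rpow h0.le hz (by linarith)

/-- Marcinkiewicz interpolation between weak types `(1,1)` and `(q,q)`. -/
theorem CZBound.isBoundedStrong_of_weak (hk : CZBound n c η k) (hn : 0 < n) [SFinite μ]
    (hμ : HasGrowth n μ) (h1 : IsBoundedWeak k 1 μ ν) (hq : IsBoundedWeak k q μ ν) (hp : 1 < p)
    (hpq : p < q) : IsBoundedStrong k p μ ν := by
  obtain ⟨C₁, hC₁⟩ := h1
  obtain ⟨C₂, hC₂⟩ := hq
  have hp0 : 0 < p := by linarith
  have hq0 : 0 < q := by linarith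
  set D : ℝ≥0∞ := ENNReal.ofReal (p / (p - 1)) * (C₁ * 2) +
    ENNReal.ofReal (p / (q - p)) * (C₂ * ENNReal.ofReal (2 ^ q)) with hD
  have hDtop : D ≠ ∞ := by
    rw [hD]
    finiteness
  refine ⟨(D ^ (1 / p)).toNNReal, fun ε hε f₀ hf₀ => ?_⟩
  obtain ⟨f, hfm, hae⟩ : ∃ f, Measurable f ∧ f₀ =ᵐ[μ] f :=
    ⟨_, hf₀.1.stronglyMeasurable_mk.measurable, hf₀.1.ae_eq_mk⟩
  have hf : MemLp f (ENNReal.ofReal p) μ := (memLp_congr_ae hae).1 hf₀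
  rw [truncOp_congr_ae hae, eLpNorm_congr_ae hae]
  have hfp := ((memLp_ofReal_iff hp0).1 hf).2
  have hdist : ∀ t : ℝ, 0 < t → ν {x | t < ‖truncOp k μ ε f x‖} ≤
      (C₁ * 2) / ENNReal.ofReal t * ∫⁻ y in {y | t ≤ ‖f y‖}, ‖f y‖ₑ ∂μ +
      (C₂ * ENNReal.ofReal (2 ^ q)) / ENNReal.ofReal (t ^ q) *
        ∫⁻ y in {y | ‖f y‖ < t}, ‖f y‖ₑ ^ q ∂μ := fun t ht => by
    -- The function is cut at the same height `t` as the level: the large part is integrable because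
    -- `1 < p`, the small part is in `L^q` because `p < q`.
    set A := {y | t ≤ ‖f y‖} with hA
    have hAm : MeasurableSet A := measurableSet_le measurable_const hfm.norm
    have hAc : Aᶜ = {y | ‖f y‖ < t} := by
      ext y
      exact not_le (a := t) (b := ‖f y‖)
    have hf1 : MemLp (A.indicator f) (ENNReal.ofReal 1) μ := by
      rw [ENNReal.ofReal_one, memLp_indicator_iff_restrict hAm, memLp_one_iff_integrable]
      refine ⟨hfm.aestronglyMeasurable, ?_⟩
      calc ∫⁻ y in A, ‖f y‖ₑ ∂μ ≤ ∫⁻ y in A, ENNReal.ofReal (t ^ (1 - p)) * ‖f y‖ₑ ^ p ∂μ := by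
            refine setLIntegral_mono' hAm fun y hy => ?_
            simpa using enorm_rpow_le_of_le_norm (r := 1) ht hp.le hy
        _ ≤ ∫⁻ y, ENNReal.ofReal (t ^ (1 - p)) * ‖f y‖ₑ ^ p ∂μ := setLIntegral_le_lintegral _ _
        _ < ∞ := by
            rw [lintegral_const_mul' _ _ ENNReal.ofReal_ne_top]
            exact ENNReal.mul_lt_top ENNReal.ofReal_lt_top hfp
    have hfq : MemLp (Aᶜ.indicator f) (ENNReal.ofReal q) μ := by
      rw [memLp_indicator_iff_restrict hAm.compl, memLp_ofReal_iff hq0]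
      refine ⟨hfm.aestronglyMeasurable, ?_⟩
      calc ∫⁻ y in Aᶜ, ‖f y‖ₑ ^ q ∂μ
          ≤ ∫⁻ y in Aᶜ, ENNReal.ofReal (t ^ (q - p)) * ‖f y‖ₑ ^ p ∂μ := by
            refine setLIntegral_mono' hAm.compl fun y hy => ?_
            rw [hAc] at hy
            exact enorm_rpow_le_of_norm_le ht hp0 hpq.le (le_of_lt hy)
        _ ≤ ∫⁻ y, ENNReal.ofReal (t ^ (q - p)) * ‖f y‖ₑ ^ p ∂μ := setLIntegral_le_lintegral _ _
        _ < ∞ := by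
            rw [lintegral_const_mul' _ _ ENNReal.ofReal_ne_top]
            exact ENNReal.mul_lt_top ENNReal.ofReal_lt_top hfp
    have hsub : {x | t < ‖truncOp k μ ε f x‖} ⊆
        {x | t / 2 < ‖truncOp k μ ε (A.indicator f) x‖} ∪
          {x | t / 2 < ‖truncOp k μ ε (Aᶜ.indicator f) x‖} := fun x hx => by
      by_contra hcon
      simp only [Set.mem_union, Set.mem_ofPred_eq, not_or, not_lt] at hcon
      have hx' : t < ‖truncOp k μ ε f x‖ := hx
      rw [← Set.indicator_self_add_compl A f,
        hk.truncOp_add hn hμ le_rfl (hp.trans hpq).le hε hf1 hfq] at hx'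
      linarith [norm_add_le (truncOp k μ ε (A.indicator f) x) (truncOp k μ ε (Aᶜ.indicator f) x)]
    refine (measure_mono hsub).trans ((measure_union_le _ _).trans (add_le_add ?_ ?_))
    · refine (hC₁ ε hε _ hf1 (t / 2) (by positivity)).trans_eq ?_
      rw [ENNReal.rpow_one, ENNReal.ofReal_one, eLpNorm_indicator_eq_eLpNorm_restrict hAm,
        eLpNorm_one_eq_lintegral_enorm, Real.rpow_one, ENNReal.ofReal_div_of_pos (by norm_num),
        ENNReal.ofReal_ofNat]
      congr 1
      rw [div_eq_mul_inv, ENNReal.inv_div (by simp) (by simp), div_eq_mul_inv, div_eq_mul_inv]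
      ring
    · refine (hC₂ ε hε _ hfq (t / 2) (by positivity)).trans_eq ?_
      rw [eLpNorm_indicator_eq_eLpNorm_restrict hAm.compl, eLpNorm_ofReal_rpow hq0, hAc,
        Real.div_rpow ht.le (by norm_num), ENNReal.ofReal_div_of_pos (by positivity)]
      congr 1
      rw [div_eq_mul_inv, ENNReal.inv_div (by simp)
        (Or.inl (by simpa using Real.rpow_pos_of_pos (two_pos (α := ℝ)) q)), div_eq_mul_inv,
        div_eq_mul_inv]
      ring
  have hres := lintegral_rpow_le_of_distribution_le hfm
    (hk.measurable_truncOp hε hf.1).aemeasurable hp hpq hdist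
  rw [ENNReal.coe_toNNReal (by finiteness), ← ENNReal.rpow_le_rpow_iff hp0,
    ENNReal.mul_rpow_of_nonneg _ _ hp0.le, ← ENNReal.rpow_mul, one_div_mul_cancel hp0.ne',
    ENNReal.rpow_one, eLpNorm_ofReal_rpow hp0, eLpNorm_ofReal_rpow hp0]
  exact hres

end

/-! ### Duality and the transposed kernel. -/

theorem eLpNorm_eq_lintegral_rpow {α E : Type*} {m : MeasurableSpace α} [NormedAddCommGroup E]
    {μ : Measure α} {p : ℝ} (hp : 0 < p) (f : α → E) :
    eLpNorm f (ENNReal.ofReal p) μ = (∫⁻ x, ‖f x‖ₑ ^ p ∂μ) ^ (1 / p) := by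
  rw [eLpNorm_eq_lintegral_rpow_enorm_toReal (by simpa using hp) ENNReal.ofReal_ne_top,
    ENNReal.toReal_ofReal hp.le]

/-- The dual characterization of the `L^q` norm, tested on integrable functions. -/
theorem eLpNorm_le_of_forall_integral_mul_le {d : ℕ} {μ : Measure (Eu d)}
    [IsLocallyFiniteMeasure μ] {p q : ℝ} (hpq : p.HolderConjugate q) {h : Eu d → ℂ}
    (hh : Measurable h) {D : ℝ≥0∞}
    (H : ∀ g : Eu d → ℂ, Integrable g μ → MemLp g (ENNReal.ofReal p) μ →
      ‖∫ y, g y * h y ∂μ‖ₑ ≤ D * eLpNorm g (ENNReal.ofReal p) μ) :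
    eLpNorm h (ENNReal.ofReal q) μ ≤ D := by
  have hp0 := hpq.pos
  have hq0 := hpq.symm.pos
  have hq1 := hpq.symm.lt
  have hexp : (q - 1) * p = q := hpq.symm.sub_one_mul_conj
  -- On these sets `h` is bounded and `μ` finite, so the extremal test function is admissible and
  -- the integral to be divided by is finite; monotone convergence removes the truncation.
  set A : ℕ → Set (Eu d) := fun N => Metric.closedBall 0 N ∩ {y | ‖h y‖ ≤ N} with hA
  have hAm : ∀ N, MeasurableSet (A N) := fun N =>
    Metric.isClosed_closedBall.measurableSet.inter (measurableSet_le hh.norm measurable_const)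
  have hAmono : Monotone A := fun N M hNM y hy => by
    have : (N : ℝ) ≤ M := by exact_mod_cast hNM
    exact ⟨Metric.closedBall_subset_closedBall this hy.1, le_trans (b := (N : ℝ)) hy.2 this⟩
  have hAU : ⋃ N, A N = Set.univ := by
    refine Set.eq_univ_of_forall fun y => ?_
    obtain ⟨N, hN⟩ := exists_nat_ge (max ‖y‖ ‖h y‖)
    refine Set.mem_iUnion.2 ⟨N, ?_, (le_max_right _ _).trans hN⟩
    simpa using (le_max_left _ _).trans hN
  have key : ∀ N, (∫⁻ y in A N, ‖h y‖ₑ ^ q ∂μ) ≤ D ^ q := fun N => by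
    have hfin : IsFiniteMeasure (μ.restrict (A N)) := ⟨by
      rw [Measure.restrict_apply_univ]
      exact (measure_mono Set.inter_subset_left).trans_lt
        (isCompact_closedBall (0 : Eu d) (N : ℝ)).measure_lt_top⟩
    -- The extremal function of Hölder's inequality: `w * h = |h| ^ q` and `|w| ^ p = |h| ^ q`.
    set w : Eu d → ℂ := fun y => ((‖h y‖ ^ (q - 2) : ℝ) : ℂ) * (starRingEnd ℂ) (h y) with hw
    have hwm : Measurable w := by
      refine (Complex.measurable_ofReal.comp (hh.norm.pow_const _)).mul ?_
      exact Complex.continuous_conj.measurable.comp hh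
    have hwn : ∀ y, ‖w y‖ = ‖h y‖ ^ (q - 1) := fun y => by
      rw [hw, norm_mul, Complex.norm_real, Real.norm_of_nonneg (by positivity), RCLike.norm_conj]
      rcases (norm_nonneg (h y)).eq_or_lt with h0 | h0
      · rw [← h0, mul_zero, Real.zero_rpow (by linarith)]
      · rw [← Real.rpow_add_one h0.ne']
        ring_nf
    have hwh : ∀ y, w y * h y = ((‖h y‖ ^ q : ℝ) : ℂ) := fun y => by
      rw [hw]
      simp only
      rw [mul_assoc, Complex.conj_mul']
      rcases (norm_nonneg (h y)).eq_or_lt with h0 | h0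
      · rw [← h0, Real.zero_rpow hq0.ne']
        simp
      · have : ‖h y‖ ^ q = ‖h y‖ ^ (q - 2) * ‖h y‖ ^ 2 := by
          rw [← Real.rpow_add_natCast h0.ne']
          norm_num
        rw [this]
        push_cast
        rfl
    have hbd : ∀ y ∈ A N, ‖h y‖ ≤ N := fun y hy => hy.2
    have hmem : ∀ s : ℝ≥0∞, MemLp ((A N).indicator w) s μ := fun s => by
      rw [memLp_indicator_iff_restrict (hAm N)]
      refine MemLp.of_bound hwm.aestronglyMeasurable ((N : ℝ) ^ (q - 1)) ?_
      filter_upwards [ae_restrict_mem (hAm N)] with y hy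
      rw [hwn]
      exact Real.rpow_le_rpow (norm_nonneg _) (hbd y hy) (by linarith)
    have hint : Integrable (fun y => ‖h y‖ ^ q) (μ.restrict (A N)) := by
      refine Integrable.of_bound (hh.norm.pow_const q).aestronglyMeasurable ((N : ℝ) ^ q) ?_
      filter_upwards [ae_restrict_mem (hAm N)] with y hy
      rw [Real.norm_of_nonneg (by positivity)]
      exact Real.rpow_le_rpow (norm_nonneg _) (hbd y hy) hq0.le
    have hpt : ∀ y, ENNReal.ofReal (‖h y‖ ^ q) = ‖h y‖ₑ ^ q := fun y => by
      rw [← ofReal_norm, ENNReal.ofReal_rpow_of_nonneg (norm_nonneg _) hq0.le]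
    have hX : ‖∫ y, (A N).indicator w y * h y ∂μ‖ₑ = ∫⁻ y in A N, ‖h y‖ₑ ^ q ∂μ := by
      have h1 : ∀ y, (A N).indicator w y * h y =
          (A N).indicator (fun y => ((‖h y‖ ^ q : ℝ) : ℂ)) y := fun y => by
        by_cases hy : y ∈ A N
        · rw [Set.indicator_of_mem hy, Set.indicator_of_mem hy, hwh]
        · rw [Set.indicator_of_notMem hy, Set.indicator_of_notMem hy, zero_mul]
      simp_rw [h1]
      rw [integral_indicator (hAm N), integral_complex_ofReal, ← ofReal_norm, Complex.norm_real,
        Real.norm_of_nonneg (integral_nonneg fun y => by positivity),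
        ofReal_integral_eq_lintegral_ofReal hint (Filter.Eventually.of_forall fun y => by positivity)]
      exact lintegral_congr fun y => hpt y
    have hXtop : ∫⁻ y in A N, ‖h y‖ₑ ^ q ∂μ ≠ ∞ := by
      have := hint.lintegral_lt_top
      simp_rw [hpt] at this
      exact this.ne
    have hg : eLpNorm ((A N).indicator w) (ENNReal.ofReal p) μ =
        (∫⁻ y in A N, ‖h y‖ₑ ^ q ∂μ) ^ (1 / p) := by
      rw [eLpNorm_indicator_eq_eLpNorm_restrict (hAm N), eLpNorm_eq_lintegral_rpow hp0]
      congr 1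
      refine lintegral_congr fun y => ?_
      rw [← ofReal_norm, hwn, ENNReal.ofReal_rpow_of_nonneg (by positivity) hp0.le,
        ← Real.rpow_mul (norm_nonneg _), hexp, hpt]
    have hmain := H _ (memLp_one_iff_integrable.1 (hmem 1)) (hmem _)
    rw [hX, hg] at hmain
    set X := ∫⁻ y in A N, ‖h y‖ₑ ^ q ∂μ
    rcases eq_or_ne X 0 with h0 | h0
    · rw [h0]
      exact zero_le
    have hsplit : X = X ^ (1 / q) * X ^ (1 / p) := by
      rw [← ENNReal.rpow_add _ _ h0 hXtop, one_div, one_div, add_comm, hpq.inv_add_inv_eq_one,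
        ENNReal.rpow_one]
    nth_rewrite 1 [hsplit] at hmain
    have hpos : X ^ (1 / p) ≠ 0 := (ENNReal.rpow_pos (pos_iff_ne_zero.2 h0) hXtop).ne'
    have hfinp : X ^ (1 / p) ≠ ∞ := ENNReal.rpow_ne_top_of_nonneg (by positivity) hXtop
    have := (ENNReal.mul_le_mul_iff_left hpos hfinp).1 hmain
    calc X = (X ^ (1 / q)) ^ q := by
          rw [← ENNReal.rpow_mul, one_div_mul_cancel hq0.ne', ENNReal.rpow_one]
      _ ≤ D ^ q := ENNReal.rpow_le_rpow this hq0.le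
  rw [← ENNReal.rpow_le_rpow_iff hq0, eLpNorm_ofReal_rpow hq0, ← setLIntegral_univ, ← hAU,
    setLIntegral_iUnion_of_directed _ hAmono.directed_le]
  exact iSup_le key

section
variable {d : ℕ} {n c η p q : ℝ} {k : Eu d → Eu d → ℂ} {μ ν : Measure (Eu d)}

/-- Fubini is justified because, for fixed `ε`, the integral of the truncated kernel against `|f|`
is bounded uniformly in the other variable, while `g` is integrable. This is why the duality
criterion is tested on integrable functions only. -/
theorem CZBound.integral_mul_truncOp_swap (hk : CZBound n c η k) (hn : 0 < n) [SFinite μ]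
    [SFinite ν] (hν : HasGrowth n ν) (hq : 1 ≤ q) {ε : ℝ} (hε : 0 < ε) {f g : Eu d → ℂ}
    (hf : MemLp f (ENNReal.ofReal q) ν) (hg : Integrable g μ) :
    ∫ y, g y * truncOp (fun x y => k y x) ν ε f y ∂μ = ∫ x, truncOp k μ ε g x * f x ∂ν := by
  obtain ⟨M, hM, hMle⟩ := hk.swap.lintegral_truncKernel_mul_le hn hν hq hε
  have hmeas : AEStronglyMeasurable (Function.uncurry fun y x =>
      g y * (truncKernel (fun x y => k y x) ε y x * f x)) (μ.prod ν) :=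
    hg.1.comp_fst.mul ((hk.swap.measurable_truncKernel hε).aestronglyMeasurable.mul hf.1.comp_snd)
  have hint : Integrable (Function.uncurry fun y x =>
      g y * (truncKernel (fun x y => k y x) ε y x * f x)) (μ.prod ν) := by
    refine ⟨hmeas, ?_⟩
    calc ∫⁻ z, ‖Function.uncurry (fun y x =>
          g y * (truncKernel (fun x y => k y x) ε y x * f x)) z‖ₑ ∂(μ.prod ν)
        = ∫⁻ y, ∫⁻ x, ‖g y * (truncKernel (fun x y => k y x) ε y x * f x)‖ₑ ∂ν ∂μ :=
          lintegral_prod _ hmeas.enorm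
      _ ≤ ∫⁻ y, ‖g y‖ₑ * (M * eLpNorm f (ENNReal.ofReal q) ν) ∂μ := by
          refine lintegral_mono fun y => ?_
          simp_rw [enorm_mul (g y)]
          rw [lintegral_const_mul' _ _ enorm_ne_top]
          exact mul_le_mul_right (hMle y f hf.1) _
      _ < ∞ := by
          rw [lintegral_mul_const' _ _ (ENNReal.mul_ne_top hM hf.2.ne)]
          exact ENNReal.mul_lt_top hg.2 (ENNReal.mul_lt_top hM.lt_top hf.2)
  calc ∫ y, g y * truncOp (fun x y => k y x) ν ε f y ∂μ
      = ∫ y, ∫ x, g y * (truncKernel (fun x y => k y x) ε y x * f x) ∂ν ∂μ := by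
        simp_rw [truncOp_eq_integral, integral_const_mul]
    _ = ∫ x, ∫ y, g y * (truncKernel (fun x y => k y x) ε y x * f x) ∂μ ∂ν :=
        integral_integral_swap hint
    _ = _ := by
        refine integral_congr_ae (Filter.Eventually.of_forall fun x => ?_)
        simp only
        rw [truncOp_eq_integral, ← integral_mul_const]
        refine integral_congr_ae (Filter.Eventually.of_forall fun y => ?_)
        simp only [truncKernel_swap]
        ring

theorem CZBound.isBoundedStrong_swap (hk : CZBound n c η k) (hn : 0 < n)
    [IsLocallyFiniteMeasure μ] [IsLocallyFiniteMeasure ν] (hν : HasGrowth n ν)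
    (hpq : p.HolderConjugate q) (hT : IsBoundedStrong k p μ ν) :
    IsBoundedStrong (fun x y => k y x) q ν μ := by
  obtain ⟨C, hC⟩ := hT
  refine ⟨C, fun ε hε f hf => ?_⟩
  refine eLpNorm_le_of_forall_integral_mul_le hpq (hk.swap.measurable_truncOp hε hf.1)
    fun g hg hgp => ?_
  rw [hk.integral_mul_truncOp_swap hn hν hpq.symm.lt.le hε hf hg]
  calc ‖∫ x, truncOp k μ ε g x * f x ∂ν‖ₑ ≤ ∫⁻ x, ‖truncOp k μ ε g x * f x‖ₑ ∂ν :=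
        enorm_integral_le_lintegral_enorm _
    _ = ∫⁻ x, ((fun x => ‖truncOp k μ ε g x‖ₑ) * fun x => ‖f x‖ₑ) x ∂ν :=
        lintegral_congr fun x => enorm_mul _ _
    _ ≤ (∫⁻ x, ‖truncOp k μ ε g x‖ₑ ^ p ∂ν) ^ (1 / p) * (∫⁻ x, ‖f x‖ₑ ^ q ∂ν) ^ (1 / q) :=
        ENNReal.lintegral_mul_le_Lp_mul_Lq ν hpq
          (hk.measurable_truncOp hε hg.1).enorm.aemeasurable hf.1.enorm
    _ = eLpNorm (truncOp k μ ε g) (ENNReal.ofReal p) ν * eLpNorm f (ENNReal.ofReal q) ν := by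
        rw [eLpNorm_eq_lintegral_rpow hpq.pos, eLpNorm_eq_lintegral_rpow hpq.symm.pos]
    _ ≤ C * eLpNorm g (ENNReal.ofReal p) μ * eLpNorm f (ENNReal.ofReal q) ν :=
        mul_le_mul_left (hC ε hε g hgp) _
    _ = _ := by ring

end

/-! ### The case `n = 0` and the assembly of all exponents. -/

theorem IsADRegular.exists_adBound {d : ℕ} {n : ℝ} (hn : 0 ≤ n) {μ : Measure (Eu d)}
    (hμ : IsADRegular n μ) (hpt : ∀ a, μ.support ≠ {a}) : ∃ a b, ADBound n a b μ := by
  obtain ⟨b, hb, hub⟩ := hμ.hasGrowth hn hpt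
  obtain ⟨a, ha, h⟩ := hμ
  exact ⟨a, b, ha, hb, fun x hx r hr hrd => (h x hx r hr hrd).1, hub⟩

theorem HasGrowth.isFiniteMeasure {d : ℕ} {μ : Measure (Eu d)} (h : HasGrowth 0 μ) :
    IsFiniteMeasure μ := by
  obtain ⟨c, hc, h⟩ := h
  have hmono : Monotone fun N : ℕ => Metric.closedBall (0 : Eu d) N := fun N M hNM =>
    Metric.closedBall_subset_closedBall (by exact_mod_cast hNM)
  refine ⟨lt_of_le_of_lt ?_ (ENNReal.ofReal_lt_top (r := c))⟩
  rw [← Metric.iUnion_closedBall_nat (0 : Eu d), hmono.measure_iUnion]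
  refine iSup_le fun N => (measure_mono (Metric.closedBall_subset_closedBall
    (by linarith : (N : ℝ) ≤ N + 1))).trans ?_
  simpa using h 0 (N + 1) (by positivity)

/-- A one-point support, allowed when `n = 0`, makes the regularity condition vacuous; finiteness
then comes from local finiteness. -/
theorem IsADRegular.isFiniteMeasure {d : ℕ} {μ : Measure (Eu d)} [IsLocallyFiniteMeasure μ]
    (h : IsADRegular 0 μ) : IsFiniteMeasure μ := by
  by_cases hpt : ∃ a, μ.support = {a}
  · obtain ⟨a, ha⟩ := hpt
    refine ⟨?_⟩
    calc μ Set.univ ≤ μ {a} + μ {a}ᶜ := by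
          rw [← Set.union_compl_self {a}]
          exact measure_union_le _ _
      _ = μ {a} := by
          rw [← ha, Measure.measure_compl_support, add_zero]
      _ < ∞ := isCompact_singleton.measure_lt_top
  · exact (h.hasGrowth le_rfl (not_exists.1 hpt)).isFiniteMeasure

section
variable {d : ℕ} {n c η a b p q : ℝ} {k : Eu d → Eu d → ℂ} {μ ν : Measure (Eu d)}

theorem CZBound.isBoundedWeak_of_strong (hk : CZBound n c η k) [SFinite ν] (hp : 0 < p)
    (h : IsBoundedStrong k p ν μ) : IsBoundedWeak k p ν μ := by
  obtain ⟨C, hC⟩ := h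
  refine ⟨C ^ p, fun ε hε f hf t ht => ?_⟩
  have hsub : {x | t < ‖truncOp k ν ε f x‖} ⊆
      {x | ENNReal.ofReal (t ^ p) ≤ ‖truncOp k ν ε f x‖ₑ ^ p} := fun x hx => by
    have hx' : t < ‖truncOp k ν ε f x‖ := hx
    change ENNReal.ofReal (t ^ p) ≤ ‖truncOp k ν ε f x‖ₑ ^ p
    rw [← ofReal_norm, ENNReal.ofReal_rpow_of_nonneg (norm_nonneg _) hp.le]
    exact ENNReal.ofReal_le_ofReal (Real.rpow_le_rpow ht.le hx'.le hp.le)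
  have htp : ENNReal.ofReal (t ^ p) ≠ 0 := by simpa using Real.rpow_pos_of_pos ht p
  calc μ {x | t < ‖truncOp k ν ε f x‖}
      ≤ (∫⁻ x, ‖truncOp k ν ε f x‖ₑ ^ p ∂μ) / ENNReal.ofReal (t ^ p) :=
        (measure_mono hsub).trans (meas_ge_le_lintegral_div
          ((hk.measurable_truncOp hε hf.1).enorm.pow_const p).aemeasurable htp
          ENNReal.ofReal_ne_top)
    _ = eLpNorm (truncOp k ν ε f) (ENNReal.ofReal p) μ ^ p / ENNReal.ofReal (t ^ p) := by
        rw [eLpNorm_ofReal_rpow hp]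
    _ ≤ (C * eLpNorm f (ENNReal.ofReal p) ν) ^ p / ENNReal.ofReal (t ^ p) := by
        gcongr
        exact hC ε hε f hf
    _ = _ := by
        rw [ENNReal.mul_rpow_of_nonneg _ _ hp.le, ENNReal.coe_rpow_of_nonneg _ hp.le,
          div_eq_mul_inv, div_eq_mul_inv]
        ring

/-- A kernel of dimension `0` is bounded by `c`, so Hölder on the finite measure `μ` bounds the
operator pointwise, and finiteness of `ν` does the rest. -/
theorem CZBound.isBoundedStrong_of_finite (hk : CZBound 0 c η k) [IsFiniteMeasure μ]
    [IsFiniteMeasure ν] (hp : 1 ≤ p) : IsBoundedStrong k p μ ν := by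
  set s : ℝ := 1 / (1 : ℝ≥0∞).toReal - 1 / (ENNReal.ofReal p).toReal with hs
  have hs0 : 0 ≤ s := by
    rw [hs, ENNReal.toReal_ofReal (by linarith), ENNReal.toReal_one]
    have : 1 / p ≤ 1 / 1 := one_div_le_one_div_of_le one_pos hp
    linarith
  have hr : 0 ≤ (ENNReal.ofReal p).toReal⁻¹ := by positivity
  refine ⟨(ENNReal.ofReal c * μ Set.univ ^ s * ν Set.univ ^ (ENNReal.ofReal p).toReal⁻¹).toNNReal,
    fun ε hε f hf => ?_⟩
  rw [ENNReal.coe_toNNReal (by finiteness)]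
  have hbound : ∀ x, ‖truncOp k μ ε f x‖ₑ ≤
      ENNReal.ofReal c * (eLpNorm f (ENNReal.ofReal p) μ * μ Set.univ ^ s) := fun x => by
    rw [truncOp_eq_integral]
    calc ‖∫ y, truncKernel k ε x y * f y ∂μ‖ₑ ≤ ∫⁻ y, ‖truncKernel k ε x y * f y‖ₑ ∂μ :=
          enorm_integral_le_lintegral_enorm _
      _ ≤ ∫⁻ y, ENNReal.ofReal c * ‖f y‖ₑ ∂μ := by
          refine lintegral_mono fun y => ?_
          rw [enorm_mul, ← ofReal_norm (truncKernel k ε x y)]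
          refine mul_le_mul_left (ENNReal.ofReal_le_ofReal ?_) _
          simpa using hk.norm_truncKernel_le_const le_rfl hε x y
      _ = ENNReal.ofReal c * eLpNorm f 1 μ := by
          rw [lintegral_const_mul' _ _ ENNReal.ofReal_ne_top, eLpNorm_one_eq_lintegral_enorm]
      _ ≤ _ := mul_le_mul_right (eLpNorm_le_eLpNorm_mul_rpow_measure_univ
          (ENNReal.one_le_ofReal.2 hp) hf.1) _
  have hfin : ENNReal.ofReal c * (eLpNorm f (ENNReal.ofReal p) μ * μ Set.univ ^ s) ≠ ∞ := by
    have := hf.2.ne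
    finiteness
  lift ENNReal.ofReal c * (eLpNorm f (ENNReal.ofReal p) μ * μ Set.univ ^ s) to ℝ≥0 using hfin
    with B hB
  refine (eLpNorm_le_of_ae_enorm_bound (Filter.Eventually.of_forall hbound)).trans_eq ?_
  rw [smul_eq_mul, hB]
  ring

/-- The potential never exceeds `c` times the mass of `τ`. Thus a nonempty level set forces `t`
below this value, and the total mass of `ν` is an adequate bound. -/
theorem CZBound.exists_measure_potential_gt_le_of_finite (hk : CZBound 0 c η k)
    [IsFiniteMeasure ν] :
    ∃ C : ℝ≥0, ∀ ε : ℝ, 0 < ε → ∀ τ : Measure (Eu d), IsFiniteMeasure τ → τ μ.supportᶜ = 0 →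
      ∀ t : ℝ, 0 < t → ν {x | t < ‖∫ y, truncKernel k ε x y ∂τ‖} ≤
        C * τ Set.univ / ENNReal.ofReal t := by
  refine ⟨(ENNReal.ofReal c * ν Set.univ).toNNReal, fun ε hε τ hτ _ t ht => ?_⟩
  rw [ENNReal.coe_toNNReal (by finiteness)]
  rcases Set.eq_empty_or_nonempty {x | t < ‖∫ y, truncKernel k ε x y ∂τ‖} with h0 | ⟨x, hx⟩
  · rw [h0, measure_empty]
    exact zero_le
  have hx' : t < ‖∫ y, truncKernel k ε x y ∂τ‖ := hx
  have hle : ENNReal.ofReal t ≤ ENNReal.ofReal c * τ Set.univ :=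
    calc ENNReal.ofReal t ≤ ‖∫ y, truncKernel k ε x y ∂τ‖ₑ := by
          rw [← ofReal_norm]
          exact ENNReal.ofReal_le_ofReal hx'.le
      _ ≤ ∫⁻ y, ‖truncKernel k ε x y‖ₑ ∂τ := enorm_integral_le_lintegral_enorm _
      _ ≤ ∫⁻ y, ENNReal.ofReal c ∂τ := by
          refine lintegral_mono fun y => ?_
          rw [← ofReal_norm]
          refine ENNReal.ofReal_le_ofReal ?_
          simpa using hk.norm_truncKernel_le_const le_rfl hε x y
      _ = _ := lintegral_const _
  rw [ENNReal.le_div_iff_mul_le (Or.inl (by simpa using ht)) (Or.inl ENNReal.ofReal_ne_top)]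
  calc ν {x | t < ‖∫ y, truncKernel k ε x y ∂τ‖} * ENNReal.ofReal t
      ≤ ν Set.univ * (ENNReal.ofReal c * τ Set.univ) :=
        mul_le_mul' (measure_mono (Set.subset_univ _)) hle
    _ = _ := by ring

theorem CZBound.isBoundedWeak_one_of_strong_two (hk : CZBound n c η k) (hn : 0 < n)
    [IsLocallyFiniteMeasure μ] (hμ : ADBound n a b μ) (hne : μ.support.Nonempty)
    (hν : HasGrowth n ν) (hT : IsBoundedStrong k 2 μ μ) : IsBoundedWeak k 1 μ ν := by
  obtain ⟨C, hC⟩ := hk.exists_measure_potential_gt_le hn hμ hne hν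
    (hk.isBoundedWeak_of_isBoundedStrong hn hμ hne one_lt_two hT hν)
  exact hk.isBoundedWeak_one hn.le hC

theorem CZBound.isBoundedStrong_of_strong_two (hk : CZBound n c η k) (hn : 0 < n)
    [IsLocallyFiniteMeasure μ] (hμ : ADBound n a b μ) (hne : μ.support.Nonempty)
    (hν : HasGrowth n ν) (hT : IsBoundedStrong k 2 μ μ) (hp : 1 < p) :
    IsBoundedStrong k p μ ν := by
  have hTt : IsBoundedStrong (fun x y => k y x) 2 μ μ :=
    hk.isBoundedStrong_swap hn hμ.hasGrowth Real.HolderConjugate.two_two hT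
  -- The exponent `max p 2 + 1` exceeds both `p` and `2`. Its conjugate is thus below `2`, where the
  -- transposed operator is bounded by interpolation; dualizing yields a weak-type endpoint above
  -- `p`.
  have hq1 : 1 < max p 2 + 1 := by linarith [le_max_left p 2]
  have hq2 : 2 < max p 2 + 1 := by linarith [le_max_right p 2]
  have hconj := Real.HolderConjugate.conjExponent hq1
  have hlt : Real.conjExponent (max p 2 + 1) < 2 := by
    rw [Real.conjExponent, div_lt_iff₀ (by linarith)]
    linarith
  have hsmall : IsBoundedStrong (fun x y => k y x) (Real.conjExponent (max p 2 + 1)) μ μ :=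
    hk.swap.isBoundedStrong_of_weak hn hμ.hasGrowth
      (hk.swap.isBoundedWeak_one_of_strong_two hn hμ hne hμ.hasGrowth hTt)
      (hk.swap.isBoundedWeak_of_isBoundedStrong hn hμ hne one_lt_two hTt hμ.hasGrowth)
      hconj.symm.lt hlt
  have hlarge : IsBoundedStrong k (max p 2 + 1) μ μ :=
    hk.swap.isBoundedStrong_swap hn hμ.hasGrowth hconj.symm hsmall
  exact hk.isBoundedStrong_of_weak hn hμ.hasGrowth
    (hk.isBoundedWeak_one_of_strong_two hn hμ hne hν hT)
    (hk.isBoundedWeak_of_isBoundedStrong hn hμ hne hq1 hlarge hν) hp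
    (by linarith [le_max_left p 2])

theorem CZBound.isBoundedStrong_symm_of_strong_two (hk : CZBound n c η k) (hn : 0 < n)
    [IsLocallyFiniteMeasure μ] [IsLocallyFiniteMeasure ν] (hμ : ADBound n a b μ)
    (hne : μ.support.Nonempty) (hν : HasGrowth n ν) (hT : IsBoundedStrong k 2 μ μ)
    (hp : 1 < p) : IsBoundedStrong k p ν μ := by
  have hTt : IsBoundedStrong (fun x y => k y x) 2 μ μ :=
    hk.isBoundedStrong_swap hn hμ.hasGrowth Real.HolderConjugate.two_two hT
  have hconj := Real.HolderConjugate.conjExponent hp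
  exact hk.swap.isBoundedStrong_swap hn hν hconj.symm
    (hk.swap.isBoundedStrong_of_strong_two hn hμ hne hν hTt hconj.symm.lt)

theorem CZBound.isBounded_of_strong (hk : CZBound n c η k) (hn : 0 ≤ n) [SFinite μ] [SFinite ν]
    (hC : ∃ C : ℝ≥0, ∀ ε : ℝ, 0 < ε → ∀ τ : Measure (Eu d), IsFiniteMeasure τ →
      τ μ.supportᶜ = 0 → ∀ t : ℝ, 0 < t → ν {x | t < ‖∫ y, truncKernel k ε x y ∂τ‖} ≤
        C * τ Set.univ / ENNReal.ofReal t)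
    (h₁ : ∀ p : ℝ, 1 < p → IsBoundedStrong k p ν μ)
    (h₂ : ∀ p : ℝ, 1 < p → IsBoundedStrong k p μ ν) :
    (∀ p : ℝ, 1 < p → IsBoundedWeak k p ν μ ∧ IsBoundedWeak k p μ ν) ∧
      IsBoundedMeasureWeak k μ.support ν ∧
      (∀ p : ℝ, 1 < p → IsBoundedStrong k p ν μ ∧ IsBoundedStrong k p μ ν) := by
  obtain ⟨C, hC⟩ := hC
  exact ⟨fun p hp => ⟨hk.isBoundedWeak_of_strong (by linarith) (h₁ p hp),
    hk.isBoundedWeak_of_strong (by linarith) (h₂ p hp)⟩, hk.isBoundedMeasureWeak hn hC,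
    fun p hp => ⟨h₁ p hp, h₂ p hp⟩⟩

end

theorem theorem4p1 {d : ℕ} {n : ℝ} (hn : 0 ≤ n)
    (μ ν : Measure (EuclideanSpace ℝ (Fin d)))
    [IsLocallyFiniteMeasure μ] [IsLocallyFiniteMeasure ν]
    (hμ : IsADRegular n μ) (hpt : 0 < n → ∀ a, μ.support ≠ {a})
    (hν : HasGrowth n ν)
    (k : EuclideanSpace ℝ (Fin d) → EuclideanSpace ℝ (Fin d) → ℂ) (hk : IsCZKernel n k)
    (hT : IsBoundedStrong k 2 μ μ) :
    (∀ p : ℝ, 1 < p → IsBoundedWeak k p ν μ ∧ IsBoundedWeak k p μ ν) ∧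
      IsBoundedMeasureWeak k μ.support ν ∧
      (∀ p : ℝ, 1 < p → IsBoundedStrong k p ν μ ∧ IsBoundedStrong k p μ ν) := by
  obtain ⟨c, η, hk⟩ := hk.exists_czBound
  rcases hn.eq_or_lt with rfl | hn0
  -- For `n = 0` the `L^2` hypothesis plays no role: finiteness and the size of the kernel give all
  -- the bounds.
  · have := hμ.isFiniteMeasure
    have := hν.isFiniteMeasure
    exact hk.isBounded_of_strong hn hk.exists_measure_potential_gt_le_of_finite
      (fun p hp => hk.isBoundedStrong_of_finite hp.le)
      (fun p hp => hk.isBoundedStrong_of_finite hp.le)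
  -- The Cotlar argument needs a nearest point of the support; if there is none, `μ = 0` and every
  -- constant can be taken to be `0`.
  rcases μ.support.eq_empty_or_nonempty with hemp | hne
  · refine hk.isBounded_of_strong hn ⟨0, fun ε _ τ _ hτ t ht => ?_⟩ (fun p _ => ⟨0, ?_⟩)
      (fun p _ => ⟨0, ?_⟩)
    · rw [hemp, Set.compl_empty, Measure.measure_univ_eq_zero] at hτ
      simp [hτ, ht.not_gt]
    · rw [Measure.support_eq_empty_iff] at hemp
      intro ε _ f _
      simp [hemp]
    · rw [Measure.support_eq_empty_iff] at hemp
      intro ε _ f _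
      rw [hemp]
      have h0 : truncOp k 0 ε f = 0 := by
        ext x
        simp [truncOp]
      simp [h0]
  obtain ⟨a, b, hab⟩ := hμ.exists_adBound hn (hpt hn0)
  exact hk.isBounded_of_strong hn
    (hk.exists_measure_potential_gt_le hn0 hab hne hν
      (hk.isBoundedWeak_of_isBoundedStrong hn0 hab hne one_lt_two hT hν))
    (fun p hp => hk.isBoundedStrong_symm_of_strong_two hn0 hab hne hν hT hp)
    (fun p hp => hk.isBoundedStrong_of_strong_two hn0 hab hne hν hT hp)
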